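/- Let $U\subset\mathbb C$ be open, with real coordinates $z=x+iy$. A \emph{complex metric} on $U$ is a smooth field $g$ of non-degenerate symmetric complex bilinear forms on the complexified tangent spaces $\mathbb C T_pU\cong\mathbb C^2$. It is \emph{positive} if, for every $p\in U$, neither of the two isotropic lines of $g_p$ (the lines spanned by $v\neq 0$ with $g_p(v,v)=0$) lies in the circle $\mathbb P T_pU\subset\mathbb P\,\mathbb C T_pU$ of lines spanned by real tangent vectors, and the two isotropic lines lie in distinct connected components of $\mathbb P\,\mathbb C T_pU\setminus\mathbb P T_pU$. Let $\nabla^g$ be the Levi-Civita connection of $g$. For a $C^2$ function $f:U\to\mathbb C$ define the gradient by $df=g(\nabla^g f,\cdot)$, the Hessian by $\mathrm{Hess}_g(f)(X,Y)=g(\nabla^g_X\nabla^g f,Y)$, and the Laplacian $\Delta_g f=\mathrm{tr}_g\,\mathrm{Hess}_g(f)$. Let $g$ be a positive complex metric on $U$ whose components are real analytic, let $V\subset\mathbb C\times\mathbb C^2$ be open, and let $F:U\times V\to\mathbb C$ be real analytic and such that for every $z\in U$ the function $F(z,\cdot)$ is the restriction to $V$ of a complex affine function on $\mathbb C\times\mathbb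 C^2$, i.e. $$F(z,a,b_1,b_2)=f_1(z)b_1+f_2(z)b_2+f_3(z)a+f_4(z).$$ Suppose that $u\in C^2(U,\mathbb C)$ satisfies $(u(z),Du(z))\in V$ for all $z\in U$, where $Du=(\partial_z u,\partial_{\bar z}u)$, and $$\Delta_g u+F(z,u,Du)=0\quad\text{on } U.$$ Then $u$ is real analytic on $U$. -/

import Mathlib

open scoped ContDiff

noncomputable section

namespace ComplexMetric

/- We work on open subsets of the plane `ℂ` with real coordinates `z = x + i y`.  The complexified
tangent space at a point is `ℂ²`, through the frame `∂_x, ∂_y` (indices `0, 1`).  A field of complex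
bilinear forms is the matrix-valued function of its components in this frame. -/

/-- The real frame `∂_x = 1`, `∂_y = i` of the plane. -/
def frame : Fin 2 → ℂ := ![1, Complex.I]

/-- The partial derivative `∂_x f` (`i = 0`) or `∂_y f` (`i = 1`) of a complex-valued function. -/
def pd (i : Fin 2) (f : ℂ → ℂ) (p : ℂ) : ℂ := fderiv ℝ f p (frame i)

/-- The Wirtinger derivative `∂_z f = (∂_x f - i ∂_y f) / 2`. -/
def dz (f : ℂ → ℂ) (p : ℂ) : ℂ := (pd 0 f p - Complex.I * pd 1 f p) / 2

/-- The Wirtinger derivative `∂_{z̄} f = (∂_x f + i ∂_y f) / 2`. -/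
def dzbar (f : ℂ → ℂ) (p : ℂ) : ℂ := (pd 0 f p + Complex.I * pd 1 f p) / 2

/-! ### The projectivized complexified tangent space -/

/-- The usual (quotient) topology on the projective line of the complexified tangent space. -/
instance projTopology : TopologicalSpace (Projectivization ℂ (Fin 2 → ℂ)) :=
  TopologicalSpace.coinduced (Projectivization.mk' ℂ) inferInstance

/-- The equatorial circle: the complex lines spanned by real tangent vectors. -/
def realDirections : Set (Projectivization ℂ (Fin 2 → ℂ)) :=
  {l | ∃ (v : Fin 2 → ℝ) (hv : (fun i => (v i : ℂ)) ≠ 0),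
    l = Projectivization.mk ℂ (fun i => (v i : ℂ)) hv}

/-- The isotropic directions of the bilinear form with matrix `B`. -/
def isotropicDirections (B : Matrix (Fin 2) (Fin 2) ℂ) :
    Set (Projectivization ℂ (Fin 2 → ℂ)) :=
  {l | ∃ (v : Fin 2 → ℂ) (hv : v ≠ 0),
    l = Projectivization.mk ℂ v hv ∧ ∑ i, ∑ j, B i j * v i * v j = 0}

/-! ### Complex metrics -/

/-- `g` is a complex metric on `U`: a smooth field of non-degenerate symmetric complex bilinear
forms on the complexified tangent spaces. -/
structure IsComplexMetricOn (g : ℂ → Matrix (Fin 2) (Fin 2) ℂ) (U : Set ℂ) : Prop where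
  smooth : ∀ i j, ContDiffOn ℝ ∞ (fun p => g p i j) U
  symm : ∀ p ∈ U, (g p).IsSymm
  nondegenerate : ∀ p ∈ U, (g p).det ≠ 0

/-- `g` is a positive complex metric on `U`: at each point no isotropic direction is real, and the
two isotropic directions lie in distinct components of the complement of the real directions. -/
structure IsPositiveComplexMetricOn (g : ℂ → Matrix (Fin 2) (Fin 2) ℂ) (U : Set ℂ) : Prop
    extends IsComplexMetricOn g U where
  not_real : ∀ p ∈ U, ∀ l ∈ isotropicDirections (g p), l ∉ realDirections
  separated : ∀ p ∈ U, ∀ l ∈ isotropicDirections (g p), ∀ l' ∈ isotropicDirections (g p),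
    l ≠ l' → connectedComponentIn realDirectionsᶜ l ≠ connectedComponentIn realDirectionsᶜ l'

/-! ### Levi-Civita connection and Laplacian -/

/-- The Christoffel symbol `Γ^k_{ij}` of the Levi-Civita connection of `g`. -/
def christoffel (g : ℂ → Matrix (Fin 2) (Fin 2) ℂ) (k i j : Fin 2) (p : ℂ) : ℂ :=
  (1 / 2) * ∑ l, (g p)⁻¹ k l *
    (pd i (fun q => g q j l) p + pd j (fun q => g q i l) p - pd l (fun q => g q i j) p)

/-- The `k`-th component of the Levi-Civita covariant derivative `∇_i X`. -/
def covDeriv (g : ℂ → Matrix (Fin 2) (Fin 2) ℂ) (X : ℂ → Fin 2 → ℂ) (i k : Fin 2) (p : ℂ) : ℂ :=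
  pd i (fun q => X q k) p + ∑ j, christoffel g k i j p * X p j

/-- The gradient of `f`, that is the vector field with `df = g(∇f, ·)`. -/
def grad (g : ℂ → Matrix (Fin 2) (Fin 2) ℂ) (f : ℂ → ℂ) (p : ℂ) : Fin 2 → ℂ :=
  fun k => ∑ l, (g p)⁻¹ k l * pd l f p

/-- The Hessian `Hess_g(f)(∂_i, ∂_j) = g(∇_i ∇f, ∂_j)`. -/
def hessian (g : ℂ → Matrix (Fin 2) (Fin 2) ℂ) (f : ℂ → ℂ) (i j : Fin 2) (p : ℂ) : ℂ :=
  ∑ k, covDeriv g (grad g f) i k p * g p k j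

/-- The Laplacian `Δ_g f`, the `g`-trace of the Hessian. -/
def laplacian (g : ℂ → Matrix (Fin 2) (Fin 2) ℂ) (f : ℂ → ℂ) (p : ℂ) : ℂ :=
  ∑ i, ∑ j, (g p)⁻¹ i j * hessian g f i j p

end ComplexMetric

end

/-! Analyticity of `u` at `p` is deduced from analytic dependence on a parameter. As `F` is affine
in `(u, Du)`, the equation near `p` is a linear equation `a x (jet u x) = f x` with analytic
coefficients. Its principal part is the inverse of `g`, which is elliptic because no isotropic
direction of `g` is real.

Let `h` be a bump function equal to 1 near `p`, and for small `t` in `ℂ` put `φ t x = u (x + t * h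
x) - u x`, a C² function supported in a small disc. By the chain rule, `u ∘ (id + t h)` solves an
equation whose coefficients at `x` are analytic functions of `x - p` and `t • jet h x`. Hence the
jets of `φ t` solve `P t (w t) = g t`, where `P` and `g` are analytic in `t` with values in
operators on `L²` and in `L²` (`exists_analytic_superposition`, `mulOperator`); the jet of `u`
itself enters `g` only as a fixed vector. At `t = 0` the operator is the original one, and an
elliptic estimate bounds it below on test functions. Since the `w t` are already known to exist,
this lower bound alone, without surjectivity, makes `t ↦ w t` analytic
(`analyticAt_of_bounded_below`). Evaluation at `p` gives `u (p + t) - u p`. Point values are not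
defined on `L²` fields of jets, so the value at `p` is carried as an extra component of the Hilbert
space.

The estimate (`exists_jet_estimate`) comes from factoring the constant coefficient operator into two
operators `∂_x - μ ∂_y` with `μ` not real, then freezing coefficients on a small disc and absorbing
lower order terms by Poincaré's inequality. The argument is assembled in
`analyticAt_of_elliptic_equation`. -/

noncomputable section

namespace ComplexMetric

open MeasureTheory Filter Topology
open scoped ComplexConjugate Convolution

/-! ### Superposition operators on spaces of continuous functions -/

section Superposition

variable {K E F : Type*} [TopologicalSpace K] [CompactSpace K]
  [NormedAddCommGroup E] [NormedSpace ℝ E] [NormedAddCommGroup F] [NormedSpace ℝ F]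

/-- A continuous multilinear map acts pointwise on continuous functions on a compact space. -/
def pointwiseMultilinear {n : ℕ} (q : E [×n]→L[ℝ] F) : C(K, E) [×n]→L[ℝ] C(K, F) :=
  MultilinearMap.mkContinuous
    { toFun := fun ξ => ⟨fun x => q fun i => ξ i x, by fun_prop⟩
      map_update_add' := by
        intro _ ξ i a b
        ext x
        have h (c : C(K, E)) : (fun j => Function.update ξ i c j x) =
            Function.update (fun j => ξ j x) i (c x) := by
          ext j
          by_cases hj : j = i
          · subst hj; simp
          · simp [hj]
        simp only [ContinuousMap.coe_mk, ContinuousMap.add_apply]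
        simp only [h, ContinuousMap.add_apply, q.map_update_add]
      map_update_smul' := by
        intro _ ξ i a b
        ext x
        have h (c : C(K, E)) : (fun j => Function.update ξ i c j x) =
            Function.update (fun j => ξ j x) i (c x) := by
          ext j
          by_cases hj : j = i
          · subst hj; simp
          · simp [hj]
        simp only [ContinuousMap.coe_mk, ContinuousMap.smul_apply]
        simp only [h, ContinuousMap.smul_apply, q.map_update_smul] } ‖q‖ (by
    intro ξ
    refine (ContinuousMap.norm_le _ (by positivity)).2 fun x => ?_
    refine (q.le_opNorm _).trans ?_
    gcongr with i
    exact (ξ i).norm_coe_le_norm x)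

theorem norm_pointwiseMultilinear_le {n : ℕ} (q : E [×n]→L[ℝ] F) :
    ‖(pointwiseMultilinear q : C(K, E) [×n]→L[ℝ] C(K, F))‖ ≤ ‖q‖ :=
  MultilinearMap.mkContinuous_norm_le _ (norm_nonneg _) _

/-- Composition with a function which is analytic at `0` is an analytic operation on the
continuous functions on a compact space with small norm. -/
theorem exists_analytic_superposition [CompleteSpace F] {G : E → F} (hG : AnalyticAt ℝ G 0) :
    ∃ r > 0, ∀ (K : Type) [TopologicalSpace K] [CompactSpace K],
      ∃ S : C(K, E) → C(K, F), ∀ ξ : C(K, E), ‖ξ‖ < r →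
        AnalyticAt ℝ S ξ ∧ ∀ x, S ξ x = G (ξ x) := by
  obtain ⟨p, r, hp⟩ := hG
  obtain ⟨ρ, hρ0, hρ⟩ := ENNReal.lt_iff_exists_nnreal_btwn.1 hp.r_pos
  -- The radius is fixed before `K`, because the disc to which this is applied is chosen in terms of
  -- it. Acting pointwise does not increase the norms of the Taylor coefficients.
  refine ⟨ρ, by exact_mod_cast hρ0, fun K _ _ => ?_⟩
  let P : FormalMultilinearSeries ℝ C(K, E) C(K, F) := fun n => pointwiseMultilinear (p n)
  have hrad : (ρ : ENNReal) < P.radius :=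
    (hρ.trans_le hp.r_le).trans_le
      (FormalMultilinearSeries.radius_le_of_le fun n => norm_pointwiseMultilinear_le (p n))
  have hP := P.hasFPowerSeriesOnBall (pos_of_gt hrad)
  refine ⟨P.sum, fun ξ hξ => ?_⟩
  have hmem : ξ ∈ Metric.eball (0 : C(K, E)) P.radius := by
    rw [Metric.mem_eball, edist_zero_right]
    refine lt_trans ?_ hrad
    rw [← ofReal_norm]
    exact (ENNReal.ofReal_lt_coe_iff (norm_nonneg _)).2 hξ
  refine ⟨hP.analyticAt_of_mem hmem, fun x => ?_⟩
  have h1 := (hP.hasSum hmem).map (ContinuousMap.evalCLM ℝ x) (ContinuousMap.evalCLM ℝ x).continuous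
  have hx : ξ x ∈ Metric.eball (0 : E) r := by
    rw [Metric.mem_eball, edist_zero_right]
    refine lt_trans ?_ hρ
    rw [← ofReal_norm]
    exact (ENNReal.ofReal_lt_coe_iff (norm_nonneg _)).2 ((ξ.norm_coe_le_norm x).trans_lt hξ)
  have h2 := hp.hasSum hx
  simp only [zero_add] at h1 h2
  exact h1.unique h2

end Superposition

/-! ### Analytic dependence on parameters in Hilbert spaces -/

/-- If `P t` is an analytic family of operators between Hilbert spaces which at `t₀` is bounded
below on a subspace `W`, solutions `w t ∈ W` of `P t (w t) = g t` depend analytically on `t`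
when `g` does. -/
theorem analyticAt_of_bounded_below {T H G : Type*} [NormedAddCommGroup T] [NormedSpace ℝ T]
    [NormedAddCommGroup H] [InnerProductSpace ℝ H] [CompleteSpace H]
    [NormedAddCommGroup G] [InnerProductSpace ℝ G] [CompleteSpace G]
    (W : Submodule ℝ H) {P : T → H →L[ℝ] G} {g : T → G} {w : T → H} {t₀ : T} {C : ℝ}
    (hP : AnalyticAt ℝ P t₀) (hg : AnalyticAt ℝ g t₀)
    (hbelow : ∀ v ∈ W, ‖v‖ ≤ C * ‖P t₀ v‖) (hw : ∀ᶠ t in 𝓝 t₀, w t ∈ W)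
    (heq : ∀ᶠ t in 𝓝 t₀, P t (w t) = g t) : AnalyticAt ℝ w t₀ := by
  -- The lower bound extends to the closure of `W`, which is a Hilbert space; there `A* A` is
  -- coercive, hence invertible.
  let X := W.topologicalClosure
  have : CompleteSpace X := W.isClosed_topologicalClosure.completeSpace_coe
  let ι : X →L[ℝ] H := X.subtypeL
  let A : X →L[ℝ] G := (P t₀).comp ι
  let D : ℝ := max C 1
  have hD : 0 < D := lt_max_of_lt_right one_pos
  have hA : ∀ v : X, ‖v‖ ≤ D * ‖A v‖ := by
    have hcl : IsClosed {v : H | ‖v‖ ≤ D * ‖P t₀ v‖} :=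
      isClosed_le continuous_norm (by fun_prop)
    have hsub : (W : Set H) ⊆ {v : H | ‖v‖ ≤ D * ‖P t₀ v‖} := fun v hv =>
      (hbelow v hv).trans (mul_le_mul_of_nonneg_right (le_max_left _ _) (norm_nonneg _))
    intro v
    have h := closure_minimal hsub hcl v.2
    exact h
  let Aadj : G →L[ℝ] X := ContinuousLinearMap.adjoint A
  -- The adjoint is frozen at `t₀`, so `Q` is analytic in `t`. It stays invertible near `t₀`, and `w
  -- t` is the inverse of `Q t` applied to `Aadj (g t)`.
  let Q : T → X →L[ℝ] X := fun t => Aadj.comp ((P t).comp ι)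
  have hunit : IsUnit (Q t₀) := by
    refine ContinuousLinearMap.isUnit_of_forall_le_norm_inner_map (Q t₀)
      (c := Real.toNNReal (D ^ 2)⁻¹) (Real.toNNReal_pos.2 (by positivity)) fun x => ?_
    have h1 : inner ℝ (Q t₀ x) x = ‖A x‖ ^ 2 := by
      rw [← real_inner_self_eq_norm_sq]
      exact ContinuousLinearMap.adjoint_inner_left A x (A x)
    rw [h1, Real.norm_of_nonneg (by positivity), Real.coe_toNNReal _ (by positivity), ← div_eq_mul_inv, div_le_iff₀ (by positivity)]
    have := pow_le_pow_left₀ (norm_nonneg x) (hA x) 2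
    linarith [mul_pow D ‖A x‖ 2]
  have hQ : AnalyticAt ℝ Q t₀ := by
    have h2 : AnalyticAt ℝ (fun t => (P t).comp ι) t₀ :=
      (((ContinuousLinearMap.compL ℝ X H G).flip ι).analyticAt _).comp hP
    exact (((ContinuousLinearMap.compL ℝ X G X) Aadj).analyticAt _).comp h2
  have hQinv : AnalyticAt ℝ (fun t => Ring.inverse (Q t)) t₀ := by
    obtain ⟨z, hz⟩ := hunit
    have h := analyticAt_inverse (𝕜 := ℝ) (A := X →L[ℝ] X) z
    exact AnalyticAt.fun_comp (by rw [← hz]; exact h) hQ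
  have hQcont : ∀ᶠ t in 𝓝 t₀, IsUnit (Q t) :=
    hQ.continuousAt.eventually
      ((Units.isOpen (R := X →L[ℝ] X)).mem_nhds hunit)
  have hsol : AnalyticAt ℝ (fun t => ι (Ring.inverse (Q t) (Aadj (g t)))) t₀ := by
    have h1 : AnalyticAt ℝ (fun t => Aadj (g t)) t₀ := (Aadj.analyticAt _).comp hg
    have h2 : AnalyticAt ℝ (fun t => Ring.inverse (Q t) (Aadj (g t))) t₀ :=
      ((ContinuousLinearMap.id ℝ (X →L[ℝ] X)).analyticAt_bilinear _).comp₂ hQinv h1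
    exact (ι.analyticAt _).comp h2
  refine hsol.congr ?_
  filter_upwards [hQcont, hw, heq] with t ht hwt heqt
  have hmem : w t ∈ X := W.le_topologicalClosure hwt
  have h1 : Q t ⟨w t, hmem⟩ = Aadj (g t) := by
    rw [← heqt]; rfl
  rw [← h1]
  have h2 : Ring.inverse (Q t) (Q t ⟨w t, hmem⟩) = ⟨w t, hmem⟩ := by
    have := Ring.inverse_mul_cancel (Q t) ht
    exact congrArg (fun B : X →L[ℝ] X => B ⟨w t, hmem⟩) this
  rw [h2]; rfl

/-! ### Multiplication operators -/

section Multiplication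

variable {K E F : Type*} [TopologicalSpace K] [CompactSpace K] [SecondCountableTopology K]
  [MeasurableSpace K] [BorelSpace K] (μ : Measure K) [IsFiniteMeasure μ]
  [NormedAddCommGroup E] [NormedSpace ℝ E] [NormedAddCommGroup F] [NormedSpace ℝ F]

/-- The operator on square integrable functions of multiplication by a continuous
operator-valued function. -/
def mulOperator : C(K, E →L[ℝ] F) →L[ℝ] (Lp E 2 μ →L[ℝ] Lp F 2 μ) :=
  -- Being continuous and linear in the coefficient, this carries analytic families of coefficients
  -- to analytic families of operators.
  ((ContinuousLinearMap.id ℝ (E →L[ℝ] F)).holderL μ ⊤ 2 2).comp (ContinuousMap.toLp ⊤ μ ℝ)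

theorem mulOperator_toLp (c : C(K, E →L[ℝ] F)) (j : C(K, E)) (k : C(K, F))
    (h : ∀ x, c x (j x) = k x) :
    mulOperator μ c (ContinuousMap.toLp 2 μ ℝ j) = ContinuousMap.toLp 2 μ ℝ k := by
  apply Lp.ext
  refine ((ContinuousLinearMap.id ℝ (E →L[ℝ] F)).coeFn_holder (r := 2)
    (ContinuousMap.toLp ⊤ μ ℝ c) (ContinuousMap.toLp 2 μ ℝ j)).trans ?_
  filter_upwards [ContinuousMap.coeFn_toLp (p := ⊤) (𝕜 := ℝ) μ c,
    ContinuousMap.coeFn_toLp (p := 2) (𝕜 := ℝ) μ j,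
    ContinuousMap.coeFn_toLp (p := 2) (𝕜 := ℝ) μ k] with x h1 h2 h3
  rw [h1, h2, h3]
  exact h x

end Multiplication

/-! ### Partial derivatives -/

theorem continuous_pd (i : Fin 2) {f : ℂ → ℂ} (hf : ContDiff ℝ 1 f) : Continuous (pd i f) :=
  (hf.continuous_fderiv one_ne_zero).clm_apply continuous_const

theorem contDiff_pd (i : Fin 2) {f : ℂ → ℂ} (hf : ContDiff ℝ 2 f) : ContDiff ℝ 1 (pd i f) :=
  (hf.fderiv_right (m := 1) (by norm_num)).clm_apply contDiff_const

theorem hasCompactSupport_pd (i : Fin 2) {f : ℂ → ℂ} (hf : HasCompactSupport f) :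
    HasCompactSupport (pd i f) :=
  hf.fderiv_apply ℝ (frame i)

theorem contDiffAt_pd (i : Fin 2) {f : ℂ → ℂ} {x : ℂ} (hf : ContDiffAt ℝ 2 f x) :
    ContDiffAt ℝ 1 (pd i f) x :=
  (hf.fderiv_right (m := 1) (by norm_num)).clm_apply contDiffAt_const

theorem pd_congr {i : Fin 2} {f g : ℂ → ℂ} {x : ℂ} (h : f =ᶠ[𝓝 x] g) : pd i f x = pd i g x := by
  rw [pd, pd, h.fderiv_eq]

theorem pd_eventuallyEq {i : Fin 2} {f g : ℂ → ℂ} {x : ℂ} (h : f =ᶠ[𝓝 x] g) :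
    pd i f =ᶠ[𝓝 x] pd i g := by
  filter_upwards [h.eventuallyEq_nhds] with y hy using pd_congr hy

theorem pd_add {i : Fin 2} {f g : ℂ → ℂ} {x : ℂ} (hf : DifferentiableAt ℝ f x)
    (hg : DifferentiableAt ℝ g x) : pd i (fun y => f y + g y) x = pd i f x + pd i g x := by
  simp [pd, fderiv_fun_add hf hg]

theorem pd_sub {i : Fin 2} {f g : ℂ → ℂ} {x : ℂ} (hf : DifferentiableAt ℝ f x)
    (hg : DifferentiableAt ℝ g x) : pd i (fun y => f y - g y) x = pd i f x - pd i g x := by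
  simp [pd, fderiv_fun_sub hf hg]

theorem pd_mul {i : Fin 2} {f g : ℂ → ℂ} {x : ℂ} (hf : DifferentiableAt ℝ f x)
    (hg : DifferentiableAt ℝ g x) :
    pd i (fun y => f y * g y) x = pd i f x * g x + f x * pd i g x := by
  simp only [pd, fderiv_fun_mul hf hg, add_apply,
    smul_apply, smul_eq_mul]
  ring

theorem pd_const_mul {i : Fin 2} (c : ℂ) {g : ℂ → ℂ} {x : ℂ} (hg : DifferentiableAt ℝ g x) :
    pd i (fun y => c * g y) x = c * pd i g x := by
  simp [pd, fderiv_const_mul hg]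

theorem pd_eq_zero_of_notMem_tsupport {i : Fin 2} {f : ℂ → ℂ} {x : ℂ} (h : x ∉ tsupport f) :
    pd i f x = 0 := by
  have := pd_congr (i := i) (notMem_tsupport_iff_eventuallyEq.1 h)
  rw [this]
  simp [pd]

theorem pd_comm {f : ℂ → ℂ} {x : ℂ} (hf : ContDiffAt ℝ 2 f x) (i j : Fin 2) :
    pd i (pd j f) x = pd j (pd i f) x := by
  have hd : DifferentiableAt ℝ (fderiv ℝ f) x :=
    (hf.fderiv_right (m := 1) (by norm_num)).differentiableAt one_ne_zero
  have key (k l : Fin 2) : pd k (pd l f) x = fderiv ℝ (fderiv ℝ f) x (frame k) (frame l) := by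
    change fderiv ℝ (fun y => fderiv ℝ f y (frame l)) x (frame k) = _
    rw [fderiv_clm_apply hd (differentiableAt_const _)]
    simp
  rw [key, key]
  exact (hf.isSymmSndFDerivAt (by simp)) _ _

/-! ### Integral identities -/

/-- The integral over the plane of the square of the absolute value. -/
def sqIntegral (f : ℂ → ℂ) : ℝ := ∫ x, ‖f x‖ ^ 2

theorem sqIntegral_nonneg (f : ℂ → ℂ) : 0 ≤ sqIntegral f :=
  integral_nonneg fun _ => by positivity

theorem integrable_norm_sq {f : ℂ → ℂ} (hf : Continuous f) (h : HasCompactSupport f) :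
    Integrable (fun x => ‖f x‖ ^ 2) := by
  refine Continuous.integrable_of_hasCompactSupport (by fun_prop) ?_
  exact h.comp_left (g := fun z => ‖z‖ ^ 2) (by simp)

theorem pd_convolution_right (L : ℂ →L[ℝ] ℂ →L[ℝ] ℂ) {p r : ℂ → ℂ} (hp : Continuous p)
    (hr : ContDiff ℝ 1 r) (hrs : HasCompactSupport r) (i : Fin 2) :
    pd i (p ⋆[L] r) = p ⋆[L] pd i r := by
  ext x
  rw [pd, (hrs.hasFDerivAt_convolution_right L hp.locallyIntegrable hr x).fderiv,
    convolution_precompR_apply L hp.locallyIntegrable (hrs.fderiv ℝ)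
      (hr.continuous_fderiv one_ne_zero)]
  rfl

theorem pd_convolution_left (L : ℂ →L[ℝ] ℂ →L[ℝ] ℂ) {p r : ℂ → ℂ} (hr : Continuous r)
    (hp : ContDiff ℝ 1 p) (hps : HasCompactSupport p) (i : Fin 2) :
    pd i (p ⋆[L] r) = pd i p ⋆[L] r := by
  rw [← convolution_flip, pd_convolution_right L.flip hr hp hps i, convolution_flip]

/-- Both sides are, up to the same sign, values at 0 of convolutions of a derivative of `ψ` with a
derivative of `r x = conj (ψ (-x))`. Derivatives move between the factors of a convolution, so `ψ`
need only be C¹. -/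
theorem integral_pd_mul_conj_pd {ψ : ℂ → ℂ} (hψ : ContDiff ℝ 1 ψ) (hs : HasCompactSupport ψ) :
    ∫ x, pd 0 ψ x * conj (pd 1 ψ x) = ∫ x, pd 1 ψ x * conj (pd 0 ψ x) := by
  let L := ContinuousLinearMap.mul ℝ ℂ
  let r : ℂ → ℂ := fun x => conj (ψ (-x))
  have hr : ContDiff ℝ 1 r := Complex.conjCLE.contDiff.comp (hψ.comp contDiff_neg)
  have hrs : HasCompactSupport r :=
    (hs.comp_homeomorph (Homeomorph.neg ℂ)).comp_left (g := conj) (map_zero _)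
  have hpr (i : Fin 2) (x : ℂ) : pd i r x = -conj (pd i ψ (-x)) := by
    have h1 : HasFDerivAt ψ (fderiv ℝ ψ (-x)) (-x) :=
      (hψ.differentiable one_ne_zero (-x)).hasFDerivAt
    have h2 := Complex.conjCLE.hasFDerivAt.comp x
      (h1.comp x ((hasFDerivAt_id x).neg))
    have h3 : fderiv ℝ r x = _ := h2.fderiv
    rw [pd, h3]
    simp [pd]
  have h1 : pd 0 ψ ⋆[L] pd 1 r = pd 1 ψ ⋆[L] pd 0 r := by
    rw [← pd_convolution_right L (continuous_pd 0 hψ) hr hrs 1,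
      ← pd_convolution_left L hr.continuous hψ hs 0,
      pd_convolution_right L hψ.continuous hr hrs 0,
      pd_convolution_left L (continuous_pd 0 hr) hψ hs 1]
  have h2 := congrFun h1 0
  simp only [convolution_def, zero_sub, hpr, neg_neg, L, ContinuousLinearMap.mul_apply',
    mul_neg, integral_neg, neg_inj] at h2
  exact h2

/-- Completing the square gives `|∂_xψ - μ ∂_yψ|² ≥ (Im μ)² |∂_yψ|² - 2 (Im μ) Im(∂_xψ conj ∂_yψ)`,
and the cross term integrates to 0 because the integral of `∂_xψ conj ∂_yψ` is real. -/
theorem im_sq_mul_sqIntegral_pd_le {ψ : ℂ → ℂ} (hψ : ContDiff ℝ 1 ψ) (hs : HasCompactSupport ψ)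
    (μ : ℂ) :
    μ.im ^ 2 * sqIntegral (pd 1 ψ) ≤ sqIntegral (fun x => pd 0 ψ x - μ * pd 1 ψ x) := by
  have c0 := continuous_pd 0 hψ
  have c1 := continuous_pd 1 hψ
  have s0 := hasCompactSupport_pd 0 hs
  have s1 := hasCompactSupport_pd 1 hs
  have hint : Integrable (fun x => pd 0 ψ x * conj (pd 1 ψ x)) :=
    Continuous.integrable_of_hasCompactSupport (by fun_prop) s0.mul_right
  have hzero : ∫ x, (pd 0 ψ x * conj (pd 1 ψ x)).im = 0 := by
    have h1 : (∫ x, pd 0 ψ x * conj (pd 1 ψ x)).im = 0 := by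
      have h := congrArg Complex.im (integral_pd_mul_conj_pd hψ hs)
      have h2 : ∫ x, pd 1 ψ x * conj (pd 0 ψ x) = conj (∫ x, pd 0 ψ x * conj (pd 1 ψ x)) := by
        rw [← integral_conj]
        congr 1
        ext x
        simp [mul_comm]
      rw [h2, Complex.conj_im] at h
      linarith
    rw [← h1]
    exact integral_im hint
  have hint' : Integrable (fun x => (pd 0 ψ x * conj (pd 1 ψ x)).im) := hint.im
  have hle : ∫ x, (μ.im ^ 2 * ‖pd 1 ψ x‖ ^ 2 - 2 * μ.im * (pd 0 ψ x * conj (pd 1 ψ x)).im) ≤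
      sqIntegral (fun x => pd 0 ψ x - μ * pd 1 ψ x) := by
    refine integral_mono (((integrable_norm_sq c1 s1).const_mul _).sub (hint'.const_mul _))
      (integrable_norm_sq (by fun_prop) (s0.sub (s1.mul_left))) fun x => ?_
    simp only [← Complex.normSq_eq_norm_sq, Complex.normSq_apply, Complex.sub_re, Complex.sub_im,
      Complex.mul_re, Complex.mul_im, Complex.conj_re, Complex.conj_im]
    nlinarith [sq_nonneg ((pd 0 ψ x).re - μ.re * (pd 1 ψ x).re),
      sq_nonneg ((pd 0 ψ x).im - μ.re * (pd 1 ψ x).im)]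
  rw [integral_sub ((integrable_norm_sq c1 s1).const_mul _) (hint'.const_mul _),
    integral_const_mul, integral_const_mul, hzero] at hle
  simpa [sqIntegral] using hle

/-- The basic elliptic estimate for the operator `∂_x - μ ∂_y` with `μ` not real. -/
theorem sqIntegral_pd_le {μ : ℂ} (hμ : μ.im ≠ 0) : ∃ C > 0, ∀ ψ : ℂ → ℂ, ContDiff ℝ 1 ψ →
    HasCompactSupport ψ → sqIntegral (pd 0 ψ) + sqIntegral (pd 1 ψ) ≤
      C * sqIntegral (fun x => pd 0 ψ x - μ * pd 1 ψ x) := by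
  refine ⟨2 + (2 * ‖μ‖ ^ 2 + 1) / μ.im ^ 2, by positivity, fun ψ hψ hs => ?_⟩
  have c0 := continuous_pd 0 hψ
  have c1 := continuous_pd 1 hψ
  have s0 := hasCompactSupport_pd 0 hs
  have s1 := hasCompactSupport_pd 1 hs
  have i1 := integrable_norm_sq c1 s1
  have i2 : Integrable (fun x => ‖pd 0 ψ x - μ * pd 1 ψ x‖ ^ 2) :=
    integrable_norm_sq (by fun_prop) (s0.sub (s1.mul_left))
  have h0 : sqIntegral (pd 0 ψ) ≤ 2 * sqIntegral (fun x => pd 0 ψ x - μ * pd 1 ψ x) +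
      2 * ‖μ‖ ^ 2 * sqIntegral (pd 1 ψ) := by
    rw [sqIntegral, sqIntegral, sqIntegral, ← integral_const_mul, ← integral_const_mul,
      ← integral_add (i2.const_mul _) (i1.const_mul _)]
    refine integral_mono (integrable_norm_sq c0 s0) ((i2.const_mul _).add (i1.const_mul _))
      fun x => ?_
    have h : ‖pd 0 ψ x‖ ≤ ‖pd 0 ψ x - μ * pd 1 ψ x‖ + ‖μ‖ * ‖pd 1 ψ x‖ := by
      rw [← norm_mul]
      simpa using norm_add_le (pd 0 ψ x - μ * pd 1 ψ x) (μ * pd 1 ψ x)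
    have h' := pow_le_pow_left₀ (norm_nonneg _) h 2
    nlinarith [sq_nonneg (‖pd 0 ψ x - μ * pd 1 ψ x‖ - ‖μ‖ * ‖pd 1 ψ x‖)]
  have h1 := im_sq_mul_sqIntegral_pd_le hψ hs μ
  have hpos : 0 < μ.im ^ 2 := by positivity
  have h2 : sqIntegral (pd 1 ψ) ≤
      sqIntegral (fun x => pd 0 ψ x - μ * pd 1 ψ x) / μ.im ^ 2 := by
    rw [le_div_iff₀ hpos]; linarith
  calc _ ≤ 2 * sqIntegral (fun x => pd 0 ψ x - μ * pd 1 ψ x) +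
      (2 * ‖μ‖ ^ 2 + 1) * sqIntegral (pd 1 ψ) := by linarith
    _ ≤ 2 * sqIntegral (fun x => pd 0 ψ x - μ * pd 1 ψ x) +
      (2 * ‖μ‖ ^ 2 + 1) * (sqIntegral (fun x => pd 0 ψ x - μ * pd 1 ψ x) / μ.im ^ 2) := by
        gcongr
    _ = _ := by ring

/-- The elliptic estimate for second order operators with constant coefficients. -/
theorem sqIntegral_pd_pd_le {A : Fin 2 → Fin 2 → ℂ}
    (hA : ∀ ξ : Fin 2 → ℝ, ξ ≠ 0 → ∑ i, ∑ j, A i j * ξ i * ξ j ≠ 0) :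
    ∃ C > 0, ∀ φ : ℂ → ℂ, ContDiff ℝ 2 φ → HasCompactSupport φ →
      ∑ i, ∑ j, sqIntegral (pd i (pd j φ)) ≤
        C * sqIntegral (fun x => ∑ i, ∑ j, A i j * pd i (pd j φ) x) := by
  simp only [Fin.sum_univ_two] at hA ⊢
  have hA0 : A 0 0 ≠ 0 := by
    have := hA ![1, 0] (by simp)
    simpa using this
  obtain ⟨s, hs⟩ := IsAlgClosed.exists_pow_nat_eq ((A 0 1 + A 1 0) ^ 2 - 4 * A 0 0 * A 1 1)
    (n := 2) (by norm_num)
  -- The symbol factors as `A 0 0 (ξ₀ - μ ξ₁)(ξ₀ - ν ξ₁)`. A real root `z` would make the symbol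
  -- vanish at the real vector `(z, 1)`.
  obtain ⟨μ, ν, h1, h2⟩ : ∃ μ ν : ℂ, A 0 1 + A 1 0 = -(A 0 0 * (μ + ν)) ∧
      A 1 1 = A 0 0 * (μ * ν) := by
    refine ⟨(-(A 0 1 + A 1 0) + s) / (2 * A 0 0), (-(A 0 1 + A 1 0) - s) / (2 * A 0 0), ?_, ?_⟩
    · field_simp; ring
    · field_simp; linear_combination hs
  have him : ∀ z : ℂ, (z = μ ∨ z = ν) → z.im ≠ 0 := by
    intro z hz h0
    refine hA ![z.re, 1] (by simp) ?_
    have hre : ((z.re : ℝ) : ℂ) = z := Complex.ext (by simp) (by simp [h0])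
    simp only [Matrix.cons_val_zero, Matrix.cons_val_one, Matrix.cons_val_fin_one, hre]
    push_cast
    rcases hz with rfl | rfl <;> linear_combination z * h1 + h2
  obtain ⟨C₁, hC₁, hμ⟩ := sqIntegral_pd_le (him μ (Or.inl rfl))
  obtain ⟨C₂, hC₂, hν⟩ := sqIntegral_pd_le (him ν (Or.inr rfl))
  have hA0' : 0 < ‖A 0 0‖ := norm_pos_iff.2 hA0
  refine ⟨C₂ * C₁ * (‖A 0 0‖ ^ 2)⁻¹, by positivity, fun φ hφ hφs => ?_⟩
  have hd (i : Fin 2) (x : ℂ) : DifferentiableAt ℝ (pd i φ) x :=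
    (contDiff_pd i hφ).differentiable one_ne_zero x
  -- The factor with `ν` commutes with `pd i`, so its estimate for `pd i φ` bounds second
  -- derivatives of `φ` by first derivatives of `ψ`; the factor with `μ` then bounds those.
  let ψ : ℂ → ℂ := fun x => pd 0 φ x - ν * pd 1 φ x
  have hψ : ContDiff ℝ 1 ψ := (contDiff_pd 0 hφ).sub (contDiff_const.mul (contDiff_pd 1 hφ))
  have hψs : HasCompactSupport ψ :=
    (hasCompactSupport_pd 0 hφs).sub (hasCompactSupport_pd 1 hφs).mul_left
  have hpψ (i : Fin 2) (x : ℂ) : pd i ψ x = pd 0 (pd i φ) x - ν * pd 1 (pd i φ) x := by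
    rw [pd_sub (hd 0 x) ((hd 1 x).const_mul ν), pd_const_mul ν (hd 1 x),
      pd_comm hφ.contDiffAt i 0, pd_comm hφ.contDiffAt i 1]
  have e (i : Fin 2) := hν (pd i φ) (contDiff_pd i hφ) (hasCompactSupport_pd i hφs)
  simp only [← hpψ] at e
  have e' := hμ ψ hψ hψs
  have hP : sqIntegral (fun x => pd 0 ψ x - μ * pd 1 ψ x) = (‖A 0 0‖ ^ 2)⁻¹ *
      sqIntegral (fun x => A 0 0 * pd 0 (pd 0 φ) x + A 0 1 * pd 0 (pd 1 φ) x +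
        (A 1 0 * pd 1 (pd 0 φ) x + A 1 1 * pd 1 (pd 1 φ) x)) := by
    rw [sqIntegral, sqIntegral, ← integral_const_mul]
    congr 1
    ext x
    rw [← inv_pow, ← norm_inv, ← mul_pow, ← norm_mul]
    congr 2
    rw [hpψ, hpψ, pd_comm hφ.contDiffAt 1 0, eq_inv_mul_iff_mul_eq₀ hA0]
    linear_combination -(pd 0 (pd 1 φ) x) * h1 - pd 1 (pd 1 φ) x * h2
  have ea := e 0
  have eb := e 1
  have e2 : C₂ * (sqIntegral (pd 0 ψ) + sqIntegral (pd 1 ψ)) ≤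
      C₂ * (C₁ * sqIntegral (fun x => pd 0 ψ x - μ * pd 1 ψ x)) := by gcongr
  rw [hP] at e2
  have e0 : sqIntegral (fun x => pd 0 ψ x) = sqIntegral (pd 0 ψ) := rfl
  have e1 : sqIntegral (fun x => pd 1 ψ x) = sqIntegral (pd 1 ψ) := rfl
  linarith

/-- Poincaré's inequality. -/
theorem sqIntegral_le_of_support {φ : ℂ → ℂ} (hφ : ContDiff ℝ 1 φ) {p : ℂ} {R : ℝ}
    (hR : 0 ≤ R) (hs : ∀ x, x ∉ Metric.closedBall p R → φ x = 0) :
    sqIntegral φ ≤ 4 * R ^ 2 * sqIntegral (pd 0 φ) := by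
  have hφs : HasCompactSupport φ := HasCompactSupport.intro (isCompact_closedBall p R) hs
  have c0 := continuous_pd 0 hφ
  have s0 := hasCompactSupport_pd 0 hφs
  have c := hφ.continuous
  let q : ℂ → ℂ := fun x => φ x * conj (φ x)
  have hq : ContDiff ℝ 1 q := hφ.mul (Complex.conjCLE.contDiff.comp hφ)
  have hqs : HasCompactSupport q := hφs.mul_right
  -- Since `∂_x l = 1` and `|l| ≤ R` on the support, integrating by parts gives `∫ |φ|² = -2 ∫ l
  -- Re(conj φ ∂_xφ)`; Young's inequality then absorbs half of the left side.
  let l : ℂ → ℂ := fun x => ((x - p).re : ℂ)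
  have hl : ContDiff ℝ 1 l :=
    Complex.ofRealCLM.contDiff.comp (Complex.reCLM.contDiff.comp (contDiff_id.sub contDiff_const))
  have hpl (x : ℂ) : fderiv ℝ l x 1 = 1 := by
    have h : HasFDerivAt l (Complex.ofRealCLM.comp Complex.reCLM) x :=
      (Complex.ofRealCLM.comp Complex.reCLM).hasFDerivAt.comp x
        ((hasFDerivAt_id x).sub_const p)
    rw [h.fderiv]
    simp
  have hpq (x : ℂ) : fderiv ℝ q x 1 = ((2 * (conj (φ x) * pd 0 φ x).re : ℝ) : ℂ) := by
    have h1 : HasFDerivAt φ (fderiv ℝ φ x) x :=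
      (hφ.differentiable one_ne_zero x).hasFDerivAt
    have h2 : HasFDerivAt (fun x => conj (φ x)) _ x := Complex.conjCLE.hasFDerivAt.comp x h1
    have h3 : fderiv ℝ q x = _ := (h1.mul h2).fderiv
    rw [h3]
    apply Complex.ext
    · simp [pd, frame]; ring
    · simp [pd, frame]; ring
  have hIBP := integral_mul_fderiv_eq_neg_fderiv_mul_of_integrable (μ := volume) (f := l) (g := q)
    (v := 1)
    (Continuous.integrable_of_hasCompactSupport
      (((hl.continuous_fderiv one_ne_zero).clm_apply continuous_const).mul hq.continuous)
      hqs.mul_left)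
    (Continuous.integrable_of_hasCompactSupport
      (hl.continuous.mul ((hq.continuous_fderiv one_ne_zero).clm_apply continuous_const))
      (hqs.fderiv_apply ℝ 1).mul_left)
    (Continuous.integrable_of_hasCompactSupport (hl.continuous.mul hq.continuous) hqs.mul_left)
    (fun x _ => hl.differentiable one_ne_zero x) (fun x _ => hq.differentiable one_ne_zero x)
  have hq2 (x : ℂ) : q x = ((‖φ x‖ ^ 2 : ℝ) : ℂ) := by
    simp [q, Complex.mul_conj, Complex.normSq_eq_norm_sq]
  simp only [hpl, hpq, one_mul, hq2, l, ← Complex.ofReal_mul] at hIBP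
  rw [integral_complex_ofReal, integral_complex_ofReal, ← Complex.ofReal_neg,
    Complex.ofReal_inj] at hIBP
  have i0 := integrable_norm_sq c0 s0
  have i1 := integrable_norm_sq c hφs
  have hbound : -∫ x, (x - p).re * (2 * (conj (φ x) * pd 0 φ x).re) ≤
      ∫ x, ((1 / 2) * ‖φ x‖ ^ 2 + 2 * R ^ 2 * ‖pd 0 φ x‖ ^ 2) := by
    rw [← integral_neg]
    refine integral_mono ?_ ((i1.const_mul _).add (i0.const_mul _)) fun x => ?_
    · refine Continuous.integrable_of_hasCompactSupport (by fun_prop) ?_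
      exact HasCompactSupport.intro (isCompact_closedBall p R) fun x hx => by simp [hs x hx]
    · by_cases hx : x ∈ Metric.closedBall p R
      · have h1 : |(x - p).re| ≤ R :=
          (Complex.abs_re_le_norm _).trans (by rwa [← dist_eq_norm])
        have h2 : |(conj (φ x) * pd 0 φ x).re| ≤ ‖φ x‖ * ‖pd 0 φ x‖ :=
          (Complex.abs_re_le_norm _).trans (by simp)
        have h3 : -((x - p).re * (2 * (conj (φ x) * pd 0 φ x).re)) ≤
            2 * (R * (‖φ x‖ * ‖pd 0 φ x‖)) := by
          have h4 := mul_le_mul h1 h2 (abs_nonneg _) hR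
          rw [← abs_mul] at h4
          have h5 := neg_abs_le ((x - p).re * (conj (φ x) * pd 0 φ x).re)
          linarith
        refine h3.trans ?_
        nlinarith [sq_nonneg (‖φ x‖ - 2 * R * ‖pd 0 φ x‖)]
      · simp only [hs x hx]
        simp
        positivity
  rw [integral_add (i1.const_mul _) (i0.const_mul _), integral_const_mul, integral_const_mul]
    at hbound
  simp only [sqIntegral]
  linarith

/-! ### Evaluation -/

theorem hasDerivAt_comp_line (i : Fin 2) {f : ℂ → ℂ} (hf : ContDiff ℝ 1 f) (z : ℂ) (s : ℝ) :
    HasDerivAt (fun s : ℝ => f (z + s * frame i)) (pd i f (z + s * frame i)) s := by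
  have h1 : HasDerivAt (fun s : ℝ => z + s * frame i) (frame i) s := by
    have h := (Complex.ofRealCLM.hasDerivAt (x := s)).mul_const (frame i)
    simpa using h.const_add z
  exact (hf.differentiable one_ne_zero _).hasFDerivAt.comp_hasDerivAt s h1

theorem enorm_le_lintegral_line (i : Fin 2) {f : ℂ → ℂ} (hf : ContDiff ℝ 1 f)
    (hs : HasCompactSupport f) (z : ℂ) (s : ℝ) :
    ‖f (z + s * frame i)‖ₑ ≤ ∫⁻ y : ℝ, ‖pd i f (z + y * frame i)‖ₑ := by
  have hline : ContDiff ℝ 1 (fun s : ℝ => z + (s : ℂ) * frame i) :=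
    contDiff_const.add (Complex.ofRealCLM.contDiff.mul contDiff_const)
  have hemb : Topology.IsClosedEmbedding (fun s : ℝ => z + (s : ℂ) * frame i) := by
    refine Isometry.isClosedEmbedding (Isometry.of_dist_eq fun a b => ?_)
    have : ‖frame i‖ = 1 := by fin_cases i <;> simp [frame]
    rw [dist_add_left, dist_eq_norm, ← sub_mul, norm_mul, this, mul_one, ← Complex.ofReal_sub,
      Complex.norm_real, dist_eq_norm]
  have h := HasCompactSupport.enorm_le_lintegral_Ici_deriv (hf.comp hline)
    (hs.comp_isClosedEmbedding hemb) s
  refine h.trans ((setLIntegral_le_lintegral _ _).trans (le_of_eq ?_))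
  congr 1
  ext y
  rw [show deriv (f ∘ fun s : ℝ => z + (s : ℂ) * frame i) y = _ from
    (hasDerivAt_comp_line i hf z y).deriv]

/-- Integrate `∂_xφ` along the horizontal line through `p`, then bound each of its values by the
integral of `∂_y∂_xφ` along the vertical line there; Tonelli joins the two integrals. -/
theorem enorm_le_lintegral_pd_pd {φ : ℂ → ℂ} (hφ : ContDiff ℝ 2 φ) (hs : HasCompactSupport φ)
    (p : ℂ) : ‖φ p‖ₑ ≤ ∫⁻ x, ‖pd 1 (pd 0 φ) x‖ₑ := by
  have hc : Continuous (pd 1 (pd 0 φ)) := continuous_pd 1 (contDiff_pd 0 hφ)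
  have hvol := (Complex.volume_preserving_equiv_real_prod.symm).lintegral_comp_emb
    (Complex.measurableEquivRealProd.symm.measurableEmbedding) fun x => ‖pd 1 (pd 0 φ) x‖ₑ
  rw [← hvol, Measure.volume_eq_prod, lintegral_prod _ (by
    refine Measurable.aemeasurable ?_
    exact hc.enorm.measurable.comp Complex.measurableEquivRealProd.symm.measurable)]
  have h0 := enorm_le_lintegral_line 0 (hφ.of_le (by norm_num)) hs (p.im * Complex.I) p.re
  have hp : (p.im * Complex.I + p.re * frame 0 : ℂ) = p := by
    simp only [frame, Matrix.cons_val_zero, mul_one]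
    rw [add_comm, Complex.re_add_im]
  rw [hp] at h0
  refine h0.trans (lintegral_mono fun x => ?_)
  have h1 := enorm_le_lintegral_line 1 (contDiff_pd 0 hφ) (hasCompactSupport_pd 0 hs) x p.im
  have e1 : (p.im * Complex.I + x * frame 0 : ℂ) = x + p.im * frame 1 := by
    simp [frame, add_comm]
  rw [e1]
  refine h1.trans (le_of_eq ?_)
  congr 1
  ext y
  congr 2
  rw [Complex.measurableEquivRealProd_symm_apply]
  apply Complex.ext <;> simp [frame]

/-- Pointwise values are controlled by the second derivatives. -/
theorem norm_sq_le_sqIntegral {φ : ℂ → ℂ} (hφ : ContDiff ℝ 2 φ) {p : ℂ} {R : ℝ}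
    (hs : ∀ x, x ∉ Metric.closedBall p R → φ x = 0) (q : ℂ) :
    ‖φ q‖ ^ 2 ≤ volume.real (Metric.closedBall p R) * sqIntegral (pd 1 (pd 0 φ)) := by
  have hφs : HasCompactSupport φ := HasCompactSupport.intro (isCompact_closedBall p R) hs
  set K := Metric.closedBall p R
  set g := pd 1 (pd 0 φ)
  have hg : Continuous g := continuous_pd 1 (contDiff_pd 0 hφ)
  have hgs : HasCompactSupport g := hasCompactSupport_pd 1 (hasCompactSupport_pd 0 hφs)
  have htφ : tsupport φ ⊆ K := closure_minimal (fun x hx => by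
    by_contra h; exact hx (hs x h)) Metric.isClosed_closedBall
  have hgK : ∀ x, x ∉ K → g x = 0 := fun x hx =>
    pd_eq_zero_of_notMem_tsupport fun h => hx (htφ
      (closure_minimal (fun y hy => by
        by_contra h'; exact hy (pd_eq_zero_of_notMem_tsupport h')) (isClosed_tsupport _) h))
  have i1 : Integrable (fun x => ‖g x‖) :=
    (Continuous.integrable_of_hasCompactSupport hg hgs).norm
  have i2 := integrable_norm_sq hg hgs
  have h1 : ‖φ q‖ ≤ ∫ x, ‖g x‖ := by
    have h := enorm_le_lintegral_pd_pd hφ hφs q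
    rw [← ofReal_integral_norm_eq_lintegral_enorm
      (Continuous.integrable_of_hasCompactSupport hg hgs), ← ofReal_norm] at h
    exact (ENNReal.ofReal_le_ofReal_iff (integral_nonneg fun _ => norm_nonneg _)).1 h
  have hKfin : volume K ≠ ⊤ := (isCompact_closedBall p R).measure_ne_top
  set m := ∫ x, ‖g x‖ with hm
  have hmK : m = ∫ x in K, ‖g x‖ :=
    (setIntegral_eq_integral_of_forall_compl_eq_zero fun x hx => by rw [hgK x hx, norm_zero]).symm
  have hSK : sqIntegral g = ∫ x in K, ‖g x‖ ^ 2 :=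
    (setIntegral_eq_integral_of_forall_compl_eq_zero fun x hx => by
      rw [hgK x hx, norm_zero, zero_pow two_ne_zero]).symm
  -- Cauchy–Schwarz on `K`, read off from the discriminant of `s ↦ ∫_K (s - |g|)²`.
  have hquad (s : ℝ) : 0 ≤ volume.real K * (s * s) + (-2 * m) * s + sqIntegral g := by
    have h : 0 ≤ ∫ x in K, (s - ‖g x‖) ^ 2 := integral_nonneg fun _ => by positivity
    have e : ∫ x in K, (s - ‖g x‖) ^ 2 =
        ∫ x in K, (s ^ 2 - 2 * s * ‖g x‖ + ‖g x‖ ^ 2) := by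
      congr 1; ext x; ring
    have i3 : IntegrableOn (fun x => 2 * s * ‖g x‖) K := i1.integrableOn.const_mul _
    have i4 : IntegrableOn (fun _ => s ^ 2) K := integrableOn_const hKfin
    have i5 : IntegrableOn (fun x => s ^ 2 - 2 * s * ‖g x‖) K := i4.sub i3
    rw [e, integral_add i5 i2.integrableOn, integral_sub i4 i3,
      integral_const_mul, ← hmK, ← hSK, setIntegral_const, smul_eq_mul] at h
    linarith
  have hdisc := discrim_le_zero hquad
  rw [discrim] at hdisc
  have hm0 := pow_le_pow_left₀ (norm_nonneg _) h1 2
  linarith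

/-! ### Jets -/

/-- The components of second order jets of functions of two variables. -/
abbrev JetIndex : Type := Unit ⊕ Fin 2 ⊕ (Fin 2 × Fin 2)

/-- The space of second order jets. -/
abbrev Jet : Type := EuclideanSpace ℂ JetIndex

/-- The second order jet of a function, with components `f`, `∂_i f`, `∂_i ∂_j f`. -/
def jet (f : ℂ → ℂ) (x : ℂ) : Jet :=
  WithLp.toLp 2 (Sum.elim (fun _ => f x)
    (Sum.elim (fun i => pd i f x) fun ij => pd ij.1 (pd ij.2 f) x))

theorem jet_inl (f : ℂ → ℂ) (x : ℂ) (i : Unit) : jet f x (.inl i) = f x := rfl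

theorem jet_inr_inl (f : ℂ → ℂ) (x : ℂ) (i : Fin 2) : jet f x (.inr (.inl i)) = pd i f x := rfl

theorem jet_inr_inr (f : ℂ → ℂ) (x : ℂ) (i j : Fin 2) :
    jet f x (.inr (.inr (i, j))) = pd i (pd j f) x := rfl

/-- The part of order two of a jet. -/
def jetTop : Jet →ₗ[ℝ] Jet where
  toFun j := WithLp.toLp 2 (Sum.elim (fun _ => 0) (Sum.elim (fun _ => 0) fun ij => j (.inr (.inr ij))))
  map_add' j k := by ext (_ | _ | _) <;> simp
  map_smul' c j := by ext (_ | _ | _) <;> simp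

theorem norm_jet_sq (f : ℂ → ℂ) (x : ℂ) : ‖jet f x‖ ^ 2 =
    ‖f x‖ ^ 2 + (∑ i, ‖pd i f x‖ ^ 2 + ∑ i, ∑ j, ‖pd i (pd j f) x‖ ^ 2) := by
  simp [EuclideanSpace.norm_sq_eq, jet, Fintype.sum_sum_type, Fintype.sum_prod_type]

theorem norm_jet_sub_jetTop_sq (f : ℂ → ℂ) (x : ℂ) : ‖jet f x - jetTop (jet f x)‖ ^ 2 =
    ‖f x‖ ^ 2 + ∑ i, ‖pd i f x‖ ^ 2 := by
  simp [EuclideanSpace.norm_sq_eq, jet, jetTop, Fintype.sum_sum_type]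

theorem continuous_jet {f : ℂ → ℂ} (hf : ContDiff ℝ 2 f) : Continuous (jet f) := by
  refine (PiLp.continuous_toLp 2 _).comp (continuous_pi ?_)
  rintro (_ | i | ij)
  · exact hf.continuous
  · exact continuous_pd i (hf.of_le (by norm_num))
  · exact continuous_pd _ (contDiff_pd _ hf)

theorem jet_eq_zero {f : ℂ → ℂ} {x : ℂ} (h : x ∉ tsupport f) : jet f x = 0 := by
  have h' := notMem_tsupport_iff_eventuallyEq.1 h
  have h0 (i : Fin 2) : pd i (0 : ℂ → ℂ) = 0 := by ext y; simp [pd]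
  ext (_ | i | ij)
  · exact h'.eq_of_nhds
  · exact pd_eq_zero_of_notMem_tsupport h
  · have := pd_congr (i := ij.1) (pd_eventuallyEq (i := ij.2) h')
    rw [h0] at this
    change pd ij.1 (pd ij.2 f) x = 0
    rw [this, h0]; rfl

/-- Freezing of coefficients: `b` is the operator at the centre and `b'` the one at a nearby point.
The factor 3 comes from `(α + β + γ)² ≤ 3 (α² + β² + γ²)`. -/
theorem norm_apply_jetTop_sq_le (b b' : Jet →L[ℝ] ℂ) {δ : ℝ} (h : ‖b' - b‖ ≤ δ) (j : Jet) :
    ‖b (jetTop j)‖ ^ 2 ≤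
      3 * (‖b' j‖ ^ 2 + (‖b‖ ^ 2 * ‖j - jetTop j‖ ^ 2 + δ ^ 2 * ‖j‖ ^ 2)) := by
  have e : b (jetTop j) = b' j - b (j - jetTop j) - (b' - b) j := by
    rw [map_sub, sub_apply]; ring
  have h2 : ‖b (jetTop j)‖ ≤ ‖b' j‖ + ‖b‖ * ‖j - jetTop j‖ + δ * ‖j‖ := by
    rw [e]
    refine (norm_sub_le _ _).trans (add_le_add ((norm_sub_le _ _).trans ?_) ?_)
    · gcongr
      exact b.le_opNorm _
    · exact ((b' - b).le_opNorm _).trans (by gcongr)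
  refine (pow_le_pow_left₀ (norm_nonneg _) h2 2).trans ?_
  rw [← mul_pow, ← mul_pow]
  generalize ‖b' j‖ = α, ‖b‖ * ‖j - jetTop j‖ = β, δ * ‖j‖ = γ
  nlinarith [sq_nonneg (α - β), sq_nonneg (α - γ), sq_nonneg (β - γ)]

/-- A priori estimate for second order operators with continuous coefficients, for functions with
support in a small disc around a point where the principal part is elliptic. -/
theorem exists_jet_estimate {a : ℂ → Jet →L[ℝ] ℂ} {p : ℂ} (ha : ContinuousAt a p)
    {A : Fin 2 → Fin 2 → ℂ}
    (hA : ∀ ξ : Fin 2 → ℝ, ξ ≠ 0 → ∑ i, ∑ j, A i j * ξ i * ξ j ≠ 0)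
    (haA : ∀ j : Jet, a p (jetTop j) = ∑ i, ∑ k, A i k * j (.inr (.inr (i, k)))) :
    ∃ R₀ > 0, ∃ C > 0, ∀ R, 0 ≤ R → R ≤ R₀ → ∀ φ : ℂ → ℂ, ContDiff ℝ 2 φ →
      (∀ x, x ∉ Metric.closedBall p R → φ x = 0) →
      IntegrableOn (fun x => ‖a x (jet φ x)‖ ^ 2) (Metric.closedBall p R) →
      ∫ x in Metric.closedBall p R, ‖jet φ x‖ ^ 2 ≤
        C * ∫ x in Metric.closedBall p R, ‖a x (jet φ x)‖ ^ 2 := by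
  obtain ⟨C₀, hC₀, hest⟩ := sqIntegral_pd_pd_le hA
  set M := ‖a p‖
  -- `δ` bounds the oscillation of the coefficients and `ε` the size of lower order terms relative
  -- to `S`. Each error will cost at most `S / 4`.
  obtain ⟨δ, hδ, hδ1⟩ : ∃ δ > 0, 3 * C₀ * (δ ^ 2 * 2) ≤ 1 / 4 := by
    refine ⟨min 1 (1 / (24 * C₀)), by positivity, ?_⟩
    have h1 := min_le_left 1 (1 / (24 * C₀))
    have h2 := min_le_right 1 (1 / (24 * C₀))
    have h0 : 0 < min 1 (1 / (24 * C₀)) := by positivity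
    rw [le_div_iff₀ (by positivity)] at h2
    nlinarith
  obtain ⟨ε, hε, hε1, hε2⟩ : ∃ ε > 0, ε ≤ 1 ∧ 3 * C₀ * (M ^ 2 * ε) ≤ 1 / 4 := by
    refine ⟨min 1 (1 / (12 * C₀ * (M ^ 2 + 1))), by positivity, min_le_left _ _, ?_⟩
    have h2 := min_le_right 1 (1 / (12 * C₀ * (M ^ 2 + 1)))
    have h0 : 0 < min 1 (1 / (12 * C₀ * (M ^ 2 + 1))) := by positivity
    rw [le_div_iff₀ (by positivity)] at h2
    nlinarith [mul_pos hC₀ h0]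
  obtain ⟨R₁, hR₁, hcont⟩ := Metric.continuousAt_iff.1 ha δ hδ
  -- The bounds `R ≤ 1` and `R ≤ ε / 20` make the Poincaré constant `4 R²` at most `ε / 5`, which
  -- yields `L ≤ ε S`. After absorption `S ≤ 6 C₀ T`, and `L + S ≤ 2 S`.
  refine ⟨min (R₁ / 2) (min 1 (ε / 20)), by positivity, 6 * C₀ * 2, by positivity,
    fun R hR0 hR φ hφ hs hint => ?_⟩
  have hRR₁ : R < R₁ := by linarith [hR.trans (min_le_left _ _)]
  have hR1 : R ≤ 1 := hR.trans ((min_le_right _ _).trans (min_le_left _ _))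
  have hRε : R ≤ ε / 20 := hR.trans ((min_le_right _ _).trans (min_le_right _ _))
  set K := Metric.closedBall p R
  have hφs : HasCompactSupport φ := HasCompactSupport.intro (isCompact_closedBall p R) hs
  have htφ : tsupport φ ⊆ K := closure_minimal (fun x hx => by
    by_contra h; exact hx (hs x h)) Metric.isClosed_closedBall
  have hjK : ∀ x, x ∉ K → jet φ x = 0 := fun x hx => jet_eq_zero fun h => hx (htφ h)
  have hp1 (i : Fin 2) := contDiff_pd i hφ
  have hφ1 : ContDiff ℝ 1 φ := hφ.of_le (by norm_num)
  set S := ∑ i, ∑ j, sqIntegral (pd i (pd j φ)) with hS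
  set L := sqIntegral φ + ∑ i, sqIntegral (pd i φ) with hL
  have iφ : Integrable (fun x => ‖φ x‖ ^ 2) := integrable_norm_sq hφ.continuous hφs
  have ip (i : Fin 2) : Integrable (fun x => ‖pd i φ x‖ ^ 2) :=
    integrable_norm_sq (hp1 i).continuous (hasCompactSupport_pd i hφs)
  have ipp (i j : Fin 2) : Integrable (fun x => ‖pd i (pd j φ) x‖ ^ 2) :=
    integrable_norm_sq (continuous_pd i (hp1 j))
      (hasCompactSupport_pd i (hasCompactSupport_pd j hφs))
  have iL : Integrable (fun x => ‖jet φ x - jetTop (jet φ x)‖ ^ 2) := by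
    simp only [norm_jet_sub_jetTop_sq]
    exact iφ.add (integrable_finsetSum _ fun i _ => ip i)
  have iS : Integrable (fun x => ∑ i, ∑ j, ‖pd i (pd j φ) x‖ ^ 2) :=
    integrable_finsetSum _ fun i _ => integrable_finsetSum _ fun j _ => ipp i j
  have iJ : Integrable (fun x => ‖jet φ x‖ ^ 2) := by
    simp only [norm_jet_sq]
    exact iφ.add ((integrable_finsetSum _ fun i _ => ip i).add iS)
  have eL : ∫ x, ‖jet φ x - jetTop (jet φ x)‖ ^ 2 = L := by
    simp only [norm_jet_sub_jetTop_sq]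
    rw [integral_add iφ (integrable_finsetSum _ fun i _ => ip i),
      integral_finsetSum _ fun i _ => ip i]
    rfl
  have eS : ∫ x, ∑ i, ∑ j, ‖pd i (pd j φ) x‖ ^ 2 = S := by
    rw [integral_finsetSum _ fun i _ => integrable_finsetSum _ fun j _ => ipp i j]
    simp only [integral_finsetSum _ fun j _ => ipp _ j]
    rfl
  have eJ : ∫ x, ‖jet φ x‖ ^ 2 = L + S := by
    simp only [norm_jet_sq, ← add_assoc, ← norm_jet_sub_jetTop_sq]
    rw [integral_add iL iS, eL, eS]
  have eJK : ∫ x in K, ‖jet φ x‖ ^ 2 = L + S := by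
    rw [← eJ]
    exact setIntegral_eq_integral_of_forall_compl_eq_zero fun x hx => by simp [hjK x hx]
  have eLK : ∫ x in K, ‖jet φ x - jetTop (jet φ x)‖ ^ 2 = L := by
    rw [← eL]
    exact setIntegral_eq_integral_of_forall_compl_eq_zero fun x hx => by simp [hjK x hx]
  have hS0 : 0 ≤ S := Finset.sum_nonneg fun i _ => Finset.sum_nonneg fun j _ => sqIntegral_nonneg _
  have hL0 : 0 ≤ L := add_nonneg (sqIntegral_nonneg _)
    (Finset.sum_nonneg fun j _ => sqIntegral_nonneg _)
  -- lower order terms are small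
  have hLS : L ≤ ε * S := by
    have hsp (i : Fin 2) : ∀ x, x ∉ K → pd i φ x = 0 := fun x hx =>
      pd_eq_zero_of_notMem_tsupport fun h => hx (htφ h)
    have p0 := sqIntegral_le_of_support hφ1 hR0 hs
    have p1 (i : Fin 2) := sqIntegral_le_of_support (hp1 i) hR0 (hsp i)
    have q0 := p1 0
    have q1 := p1 1
    have n00 := sqIntegral_nonneg (pd 0 (pd 0 φ))
    have n01 := sqIntegral_nonneg (pd 0 (pd 1 φ))
    have n10 := sqIntegral_nonneg (pd 1 (pd 0 φ))
    have n11 := sqIntegral_nonneg (pd 1 (pd 1 φ))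
    simp only [hL, hS, Fin.sum_univ_two]
    have hR2 : 4 * R ^ 2 ≤ ε / 5 := by nlinarith
    have hR21 : 4 * R ^ 2 ≤ 4 := by nlinarith
    have u0 : sqIntegral (pd 0 φ) ≤ ε / 5 * sqIntegral (pd 0 (pd 0 φ)) :=
      q0.trans (mul_le_mul_of_nonneg_right hR2 n00)
    have u1 : sqIntegral (pd 1 φ) ≤ ε / 5 * sqIntegral (pd 0 (pd 1 φ)) :=
      q1.trans (mul_le_mul_of_nonneg_right hR2 n01)
    have u2 : sqIntegral φ ≤ 4 * sqIntegral (pd 0 φ) :=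
      p0.trans (mul_le_mul_of_nonneg_right hR21 (sqIntegral_nonneg _))
    nlinarith [mul_nonneg hε.le n00, mul_nonneg hε.le n01, mul_nonneg hε.le n10,
      mul_nonneg hε.le n11]
  have hLS' : L ≤ S := hLS.trans (by nlinarith)
  set T := ∫ x in K, ‖a x (jet φ x)‖ ^ 2
  -- the frozen operator
  have hmain : sqIntegral (fun x => ∑ i, ∑ j, A i j * pd i (pd j φ) x) ≤
      3 * (T + (M ^ 2 * L + δ ^ 2 * (L + S))) := by
    have hpa (x : ℂ) : ∑ i, ∑ j, A i j * pd i (pd j φ) x = a p (jetTop (jet φ x)) := by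
      simp only [haA, jet_inr_inr]
    simp only [hpa, sqIntegral]
    have k1 : IntegrableOn (fun x => M ^ 2 * ‖jet φ x - jetTop (jet φ x)‖ ^ 2) K :=
      iL.integrableOn.const_mul _
    have k2 : IntegrableOn (fun x => δ ^ 2 * ‖jet φ x‖ ^ 2) K := iJ.integrableOn.const_mul _
    have k3 : IntegrableOn (fun x => M ^ 2 * ‖jet φ x - jetTop (jet φ x)‖ ^ 2 +
      δ ^ 2 * ‖jet φ x‖ ^ 2) K := k1.add k2
    have k4 : IntegrableOn (fun x => ‖a x (jet φ x)‖ ^ 2 +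
      (M ^ 2 * ‖jet φ x - jetTop (jet φ x)‖ ^ 2 + δ ^ 2 * ‖jet φ x‖ ^ 2)) K := hint.add k3
    have k5 : IntegrableOn (fun x => 3 * (‖a x (jet φ x)‖ ^ 2 +
      (M ^ 2 * ‖jet φ x - jetTop (jet φ x)‖ ^ 2 + δ ^ 2 * ‖jet φ x‖ ^ 2))) K := k4.const_mul 3
    rw [← setIntegral_eq_integral_of_forall_compl_eq_zero (s := K)
      (fun x hx => by rw [hjK x hx, map_zero, map_zero, norm_zero, zero_pow two_ne_zero]),
      ← eJK, ← eLK, ← integral_const_mul, ← integral_const_mul,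
      ← integral_add k1 k2, ← integral_add hint k3, ← integral_const_mul]
    refine integral_mono_of_nonneg (Eventually.of_forall fun _ => sq_nonneg _) k5 ?_
    filter_upwards [ae_restrict_mem Metric.isClosed_closedBall.measurableSet] with x hx
    have hx' : dist x p < R₁ := (Metric.mem_closedBall.1 hx).trans_lt hRR₁
    have h1 : ‖a x - a p‖ ≤ δ := by
      rw [← dist_eq_norm]; exact (hcont hx').le
    exact norm_apply_jetTop_sq_le (a p) (a x) h1 (jet φ x)
  have hS1 : S ≤ C₀ * (3 * (T + (M ^ 2 * L + δ ^ 2 * (L + S)))) :=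
    (hest φ hφ hφs).trans (by gcongr)
  have hb1 : 3 * C₀ * (M ^ 2 * L) ≤ 1 / 4 * S := by
    calc 3 * C₀ * (M ^ 2 * L) ≤ 3 * C₀ * (M ^ 2 * (ε * S)) := by gcongr
      _ = 3 * C₀ * (M ^ 2 * ε) * S := by ring
      _ ≤ 1 / 4 * S := by gcongr
  have hb2 : 3 * C₀ * (δ ^ 2 * (L + S)) ≤ 1 / 4 * S := by
    calc 3 * C₀ * (δ ^ 2 * (L + S)) ≤ 3 * C₀ * (δ ^ 2 * (S + S)) := by gcongr
      _ = 3 * C₀ * (δ ^ 2 * 2) * S := by ring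
      _ ≤ 1 / 4 * S := by gcongr
  rw [eJK]
  linarith

/-! ### Transformation of jets under deformations of the identity -/

/-- The real coordinates of a tangent vector. -/
def coord : Fin 2 → ℂ →L[ℝ] ℝ := ![Complex.reCLM, Complex.imCLM]

theorem coord_frame (k i : Fin 2) : coord k (frame i) = if k = i then 1 else 0 := by
  fin_cases k <;> fin_cases i <;> simp [coord, frame]

theorem clm_apply_eq_sum_coord (T : ℂ →L[ℝ] ℂ) (c : ℂ) :
    T c = ∑ k, (coord k c : ℂ) * T (frame k) := by
  have h : c = c.re • (1 : ℂ) + c.im • Complex.I := by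
    simp [Complex.re_add_im]
  conv_lhs => rw [h]
  rw [map_add, map_smul, map_smul]
  simp [coord, frame]

/-- The matrix which expresses the jet of `f ∘ (id + h)` at `x` in terms of the jet of `f` at
`x + h x`; here `θ` is the jet of `h` at `x`. -/
def transportEntry (θ : Jet) : JetIndex → JetIndex → ℝ
  | .inl _, .inl _ => 1
  | .inl _, .inr _ => 0
  | .inr (.inl i), .inr (.inl k) => coord k (frame i + θ (.inr (.inl i)))
  | .inr (.inl _), .inl _ => 0
  | .inr (.inl _), .inr (.inr _) => 0
  | .inr (.inr _), .inl _ => 0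
  | .inr (.inr ij), .inr (.inl k) => coord k (θ (.inr (.inr ij)))
  | .inr (.inr ij), .inr (.inr lk) => coord lk.1 (frame ij.1 + θ (.inr (.inl ij.1))) *
      coord lk.2 (frame ij.2 + θ (.inr (.inl ij.2)))

/-- Evaluation of a component of a jet. -/
def jetProj (b : JetIndex) : Jet →L[ℝ] ℂ :=
  (EuclideanSpace.proj b : Jet →L[ℂ] ℂ).restrictScalars ℝ

theorem jetProj_apply (b : JetIndex) (j : Jet) : jetProj b j = j b := rfl

/-- The inclusion of a component in the space of jets. -/
def jetSingle (b : JetIndex) : ℂ →L[ℝ] Jet :=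
  ((ContinuousLinearMap.toSpanSingleton ℂ (EuclideanSpace.single b 1 : Jet)) :
    ℂ →L[ℂ] Jet).restrictScalars ℝ

theorem jetSingle_apply (b c : JetIndex) (z : ℂ) : jetSingle b z c = if c = b then z else 0 := by
  simp [jetSingle]

/-- The linear map of jets with matrix `transportEntry`. -/
def transport (θ : Jet) : Jet →L[ℝ] Jet :=
  ∑ b, ∑ c, transportEntry θ b c • (jetSingle b).comp (jetProj c)

theorem transport_apply (θ q : Jet) (b : JetIndex) :
    transport θ q b = ∑ c, (transportEntry θ b c : ℂ) * q c := by
  rw [← jetProj_apply b]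
  simp only [transport, sum_apply, smul_apply, ContinuousLinearMap.comp_apply, map_sum, map_smul]
  simp only [jetProj_apply, jetSingle_apply]
  rw [Finset.sum_eq_single b]
  · simp
  · intro c _ hc
    simp [Ne.symm hc]
  · simp

/-- This makes `transport` invertible for small jets and identifies the deformed operator at `t = 0`
with the original one. -/
theorem transport_zero : transport 0 = 1 := by
  ext q b
  rw [transport_apply]
  rcases b with _ | i | ⟨i, j⟩
  · simp [transportEntry]
  · fin_cases i <;> simp [transportEntry, coord_frame]
  · simp only [Fintype.sum_sum_type, Fintype.sum_prod_type, transportEntry]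
    fin_cases i <;> fin_cases j <;> simp [coord_frame]

theorem analyticAt_transport (θ : Jet) : AnalyticAt ℝ transport θ := by
  have hp (b : JetIndex) : AnalyticAt ℝ (fun θ : Jet => θ b) θ := (jetProj b).analyticAt θ
  have hc (k : Fin 2) {f : Jet → ℂ} (hf : AnalyticAt ℝ f θ) :
      AnalyticAt ℝ (fun θ => coord k (f θ)) θ := ((coord k).analyticAt _).comp hf
  unfold transport
  refine Finset.analyticAt_fun_sum _ fun b _ => Finset.analyticAt_fun_sum _ fun c _ => ?_
  refine AnalyticAt.fun_smul ?_ analyticAt_const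
  rcases b with _ | i | ij <;> rcases c with _ | k | lk <;> simp only [transportEntry]
  · exact analyticAt_const
  · exact analyticAt_const
  · exact analyticAt_const
  · exact analyticAt_const
  · exact hc k (analyticAt_const.add (hp _))
  · exact analyticAt_const
  · exact analyticAt_const
  · exact hc k (hp _)
  · exact (hc _ (analyticAt_const.add (hp _))).mul (hc _ (analyticAt_const.add (hp _)))

theorem pd_comp_id_add {f h : ℂ → ℂ} {x : ℂ} (hf : DifferentiableAt ℝ f (x + h x))
    (hh : DifferentiableAt ℝ h x) (i : Fin 2) :
    pd i (fun y => f (y + h y)) x =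
      ∑ k, (coord k (frame i + pd i h x) : ℂ) * pd k f (x + h x) := by
  have h1 := hf.hasFDerivAt.comp x ((hasFDerivAt_id x).add hh.hasFDerivAt)
  have h2 : fderiv ℝ (fun y => f (y + h y)) x = _ := h1.fderiv
  rw [pd, h2]
  exact clm_apply_eq_sum_coord (fderiv ℝ f (x + h x)) _

theorem pd_coord {h : ℂ → ℂ} {x : ℂ} (hh : DifferentiableAt ℝ h x) (i k : Fin 2) (c : ℂ) :
    pd i (fun y => (coord k (c + h y) : ℂ)) x = (coord k (pd i h x) : ℂ) := by
  have h1 : HasFDerivAt (fun y => (coord k (c + h y) : ℂ))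
      ((Complex.ofRealCLM.comp (coord k)).comp (fderiv ℝ h x)) x :=
    (Complex.ofRealCLM.comp (coord k)).hasFDerivAt.comp x (hh.hasFDerivAt.const_add c)
  rw [pd, h1.fderiv]
  rfl

theorem differentiableAt_coord {h : ℂ → ℂ} {x : ℂ} (hh : DifferentiableAt ℝ h x) (k : Fin 2)
    (c : ℂ) : DifferentiableAt ℝ (fun y => (coord k (c + h y) : ℂ)) x :=
  (Complex.ofRealCLM.comp (coord k)).differentiableAt.comp x (hh.const_add c)

/-- The chain rule for second order jets. -/
theorem jet_comp_id_add {f h : ℂ → ℂ} {x : ℂ} (hf : ContDiffAt ℝ 2 f (x + h x))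
    (hh : ContDiffAt ℝ 2 h x) :
    jet (fun y => f (y + h y)) x = transport (jet h x) (jet f (x + h x)) := by
  have hcont : ContinuousAt (fun y => y + h y) x := continuousAt_id.add hh.continuousAt
  have hfd : ∀ᶠ y in 𝓝 x, DifferentiableAt ℝ f (y + h y) :=
    hcont.eventually ((hf.eventually (by simp)).mono fun y hy => hy.differentiableAt two_ne_zero)
  have hhd : ∀ᶠ y in 𝓝 x, DifferentiableAt ℝ h y :=
    (hh.eventually (by simp)).mono fun y hy => hy.differentiableAt two_ne_zero
  have hd1 (j : Fin 2) : DifferentiableAt ℝ (pd j h) x :=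
    (contDiffAt_pd j hh).differentiableAt one_ne_zero
  have hd2 (j : Fin 2) : DifferentiableAt ℝ (pd j f) (x + h x) :=
    (contDiffAt_pd j hf).differentiableAt one_ne_zero
  have hd3 : DifferentiableAt ℝ (fun y => y + h y) x := differentiableAt_id.add hhd.self_of_nhds
  ext b
  rw [transport_apply]
  rcases b with _ | i | ⟨i, j⟩
  · simp [transportEntry, jet_inl]
  · rw [jet_inr_inl, pd_comp_id_add hfd.self_of_nhds hhd.self_of_nhds]
    simp [transportEntry, jet_inr_inl]
  · have e : pd j (fun y => f (y + h y)) =ᶠ[𝓝 x]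
        fun y => ∑ k, (coord k (frame j + pd j h y) : ℂ) * pd k f (y + h y) := by
      filter_upwards [hfd, hhd] with y h1 h2 using pd_comp_id_add h1 h2 j
    have ht (k : Fin 2) : DifferentiableAt ℝ
        (fun y => (coord k (frame j + pd j h y) : ℂ) * pd k f (y + h y)) x :=
      (differentiableAt_coord (hd1 j) k _).mul
        (DifferentiableAt.comp x (g := pd k f) (hd2 k) hd3)
    rw [jet_inr_inr, pd_congr e]
    simp only [Fin.sum_univ_two] at ht ⊢
    rw [pd_add (ht 0) (ht 1)]
    have hm (k : Fin 2) := pd_mul (i := i) (differentiableAt_coord (hd1 j) k (frame j))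
      (DifferentiableAt.comp x (g := pd k f) (hd2 k) hd3)
    simp only [Function.comp_def] at hm
    rw [hm 0, hm 1, pd_coord (hd1 j), pd_coord (hd1 j),
      pd_comp_id_add (hd2 0) hhd.self_of_nhds, pd_comp_id_add (hd2 1) hhd.self_of_nhds]
    simp only [Fintype.sum_sum_type, Fintype.sum_prod_type, transportEntry, jet_inr_inl,
      jet_inr_inr, Fin.sum_univ_two]
    push_cast
    simp only [Finset.univ_unique, Finset.sum_const_zero, zero_mul, zero_add]
    ring

theorem jet_sub {f h : ℂ → ℂ} {x : ℂ} (hf : ContDiffAt ℝ 2 f x) (hh : ContDiffAt ℝ 2 h x) :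
    jet (fun y => f y - h y) x = jet f x - jet h x := by
  have d {f : ℂ → ℂ} (hf : ContDiffAt ℝ 2 f x) : ∀ᶠ y in 𝓝 x, DifferentiableAt ℝ f y :=
    (hf.eventually (by simp)).mono fun y hy => hy.differentiableAt two_ne_zero
  have d1 (j : Fin 2) {f : ℂ → ℂ} (hf : ContDiffAt ℝ 2 f x) : DifferentiableAt ℝ (pd j f) x :=
    (contDiffAt_pd j hf).differentiableAt one_ne_zero
  ext (_ | i | ⟨i, j⟩)
  · rfl
  · exact pd_sub (d hf).self_of_nhds (d hh).self_of_nhds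
  · have e : pd j (fun y => f y - h y) =ᶠ[𝓝 x] fun y => pd j f y - pd j h y := by
      filter_upwards [d hf, d hh] with y h1 h2 using pd_sub h1 h2
    change pd i (pd j fun y => f y - h y) x = pd i (pd j f) x - pd i (pd j h) x
    rw [pd_congr e, pd_sub (d1 j hf) (d1 j hh)]

theorem jet_const_mul {h : ℂ → ℂ} {x : ℂ} (c : ℂ) (hh : ContDiffAt ℝ 2 h x) :
    jet (fun y => c * h y) x = c • jet h x := by
  have d : ∀ᶠ y in 𝓝 x, DifferentiableAt ℝ h y :=
    (hh.eventually (by simp)).mono fun y hy => hy.differentiableAt two_ne_zero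
  ext (_ | i | ⟨i, j⟩)
  · rfl
  · exact pd_const_mul c d.self_of_nhds
  · have e : pd j (fun y => c * h y) =ᶠ[𝓝 x] fun y => c * pd j h y := by
      filter_upwards [d] with y h1 using pd_const_mul c h1
    change pd i (pd j fun y => c * h y) x = c * pd i (pd j h) x
    rw [pd_congr e, pd_const_mul c ((contDiffAt_pd j hh).differentiableAt one_ne_zero)]

theorem jet_add {f h : ℂ → ℂ} {x : ℂ} (hf : ContDiffAt ℝ 2 f x) (hh : ContDiffAt ℝ 2 h x) :
    jet (fun y => f y + h y) x = jet f x + jet h x := by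
  have e := jet_sub hf (contDiffAt_const.mul hh : ContDiffAt ℝ 2 (fun y => (-1 : ℂ) * h y) x)
  rw [jet_const_mul (-1) hh] at e
  simpa using e

/-! ### Square integrable functions on discs -/

/-- Lebesgue measure on a closed disc. -/
def discMeasure (p : ℂ) (R : ℝ) : Measure (Metric.closedBall p R) :=
  (volume : Measure ℂ).comap Subtype.val

instance isFiniteMeasure_discMeasure (p : ℂ) (R : ℝ) : IsFiniteMeasure (discMeasure p R) where
  measure_univ_lt_top := by
    rw [discMeasure, comap_subtype_coe_apply Metric.isClosed_closedBall.measurableSet]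
    rw [Set.image_univ, Subtype.range_coe]
    exact (isCompact_closedBall p R).measure_lt_top

theorem norm_toLp_disc_sq {E : Type*} [NormedAddCommGroup E] [InnerProductSpace ℝ E] {p : ℂ}
    {R : ℝ} (j : C(Metric.closedBall p R, E)) {f : ℂ → E} (hf : ∀ x, j x = f x) :
    ‖ContinuousMap.toLp (E := E) 2 (discMeasure p R) ℝ j‖ ^ 2 =
      ∫ x in Metric.closedBall p R, ‖f x‖ ^ 2 := by
  rw [← real_inner_self_eq_norm_sq, L2.inner_def,
    ← integral_subtype_comap Metric.isClosed_closedBall.measurableSet]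
  refine integral_congr_ae ?_
  filter_upwards [ContinuousMap.coeFn_toLp (E := E) (p := 2) (𝕜 := ℝ) (discMeasure p R) j] with x hx
  rw [hx, real_inner_self_eq_norm_sq, hf]

theorem continuousAt_jet {f : ℂ → ℂ} {x : ℂ} (hf : ContDiffAt ℝ 2 f x) :
    ContinuousAt (jet f) x := by
  refine (PiLp.continuous_toLp 2 _).continuousAt.comp (continuousAt_pi.2 ?_)
  rintro (_ | i | ij)
  · exact hf.continuousAt
  · exact (contDiffAt_pd i hf).continuousAt
  · exact ((contDiffAt_pd ij.2 hf).fderiv_right (m := 0) (by norm_num)).continuousAt.clm_apply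
      continuousAt_const

/-- The twice continuously differentiable functions which vanish outside of a closed disc. -/
def testFunctions (p : ℂ) (R : ℝ) : Submodule ℝ (ℂ → ℂ) where
  carrier := {φ | ContDiff ℝ 2 φ ∧ ∀ x, x ∉ Metric.closedBall p R → φ x = 0}
  add_mem' := fun ha hb => ⟨ha.1.add hb.1, fun x hx => by simp [ha.2 x hx, hb.2 x hx]⟩
  zero_mem' := ⟨contDiff_const, fun _ _ => rfl⟩
  smul_mem' := fun c _ ha => ⟨contDiff_const.smul ha.1, fun x hx => by simp [ha.2 x hx]⟩

/-- The jet of a test function. -/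
def testJet (p : ℂ) (R : ℝ) : testFunctions p R →ₗ[ℝ] C(Metric.closedBall p R, Jet) where
  toFun φ := ⟨fun x => jet φ x, (continuous_jet φ.2.1).comp continuous_subtype_val⟩
  map_add' φ ψ := by
    ext1 x
    exact jet_add φ.2.1.contDiffAt ψ.2.1.contDiffAt
  map_smul' c φ := by
    ext1 x
    have h := jet_const_mul (x := x) (c : ℂ) φ.2.1.contDiffAt
    have e : ((c • φ : testFunctions p R) : ℂ → ℂ) = fun y => (c : ℂ) * (φ : ℂ → ℂ) y := by
      ext y; simp
    change jet ((c • φ : testFunctions p R) : ℂ → ℂ) x = c • jet φ x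
    rw [e, h]
    ext b
    simp

/-- The Hilbert space of square integrable fields of jets on a disc, together with a value. -/
abbrev JetField (p : ℂ) (R : ℝ) : Type := WithLp 2 (Lp Jet 2 (discMeasure p R) × ℂ)

/-- The jet of a test function as a square integrable field, together with the value of the
function at the centre. -/
def testField (p : ℂ) (R : ℝ) : testFunctions p R →ₗ[ℝ] JetField p R :=
  (WithLp.linearEquiv 2 ℝ (Lp Jet 2 (discMeasure p R) × ℂ)).symm.toLinearMap ∘ₗ
    (((ContinuousMap.toLp 2 (discMeasure p R) ℝ).toLinearMap ∘ₗ testJet p R).prod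
      ((LinearMap.proj p : (ℂ → ℂ) →ₗ[ℝ] ℂ) ∘ₗ (testFunctions p R).subtype))

theorem testField_fst {p : ℂ} {R : ℝ} (φ : testFunctions p R) :
    (testField p R φ).fst = ContinuousMap.toLp 2 (discMeasure p R) ℝ (testJet p R φ) := rfl

theorem testField_snd {p : ℂ} {R : ℝ} (φ : testFunctions p R) :
    (testField p R φ).snd = (φ : ℂ → ℂ) p := rfl

/-- The estimate for elliptic operators as a lower bound for a multiplication operator. -/
theorem norm_testField_le {a : ℂ → Jet →L[ℝ] ℂ} {p : ℂ} {R C : ℝ} (hC : 0 ≤ C)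
    (c : C(Metric.closedBall p R, Jet →L[ℝ] ℂ)) (hc : ∀ x, c x = a x)
    (hest : ∀ φ : ℂ → ℂ, ContDiff ℝ 2 φ →
      (∀ x, x ∉ Metric.closedBall p R → φ x = 0) →
      IntegrableOn (fun x => ‖a x (jet φ x)‖ ^ 2) (Metric.closedBall p R) →
      ∫ x in Metric.closedBall p R, ‖jet φ x‖ ^ 2 ≤
        C * ∫ x in Metric.closedBall p R, ‖a x (jet φ x)‖ ^ 2) (φ : testFunctions p R) :
    ‖testField p R φ‖ ≤ √((1 + volume.real (Metric.closedBall p R)) * C) *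
      ‖mulOperator (discMeasure p R) c (testField p R φ).fst‖ := by
  have hcont : Continuous fun x : Metric.closedBall p R => c x (testJet p R φ x) := by fun_prop
  have hcK : ContinuousOn (fun x => a x (jet φ x)) (Metric.closedBall p R) := by
    rw [continuousOn_iff_continuous_domRestrict]
    refine hcont.congr fun x => ?_
    rw [hc]; rfl
  have hint : IntegrableOn (fun x => ‖a x (jet φ x)‖ ^ 2) (Metric.closedBall p R) :=
    (hcK.norm.pow 2).integrableOn_compact (isCompact_closedBall p R)
  have h1 := hest φ φ.2.1 φ.2.2 hint
  have h2 := norm_sq_le_sqIntegral φ.2.1 φ.2.2 p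
  have hφs : HasCompactSupport (φ : ℂ → ℂ) :=
    HasCompactSupport.intro (isCompact_closedBall p R) φ.2.2
  have htφ : tsupport (φ : ℂ → ℂ) ⊆ (Metric.closedBall p R) := closure_minimal (fun x hx => by
    by_contra h; exact hx (φ.2.2 x h)) Metric.isClosed_closedBall
  have h3 : sqIntegral (pd 1 (pd 0 φ)) ≤ ∫ x in Metric.closedBall p R, ‖jet φ x‖ ^ 2 := by
    rw [sqIntegral, ← setIntegral_eq_integral_of_forall_compl_eq_zero (s := (Metric.closedBall p R)) fun x hx => by
      have h0 := jet_eq_zero fun h => hx (htφ h)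
      rw [← jet_inr_inr, h0]
      simp]
    refine setIntegral_mono
      (integrable_norm_sq (continuous_pd 1 (contDiff_pd 0 φ.2.1))
        (hasCompactSupport_pd 1 (hasCompactSupport_pd 0 hφs))).integrableOn
      (((continuous_jet φ.2.1).norm.pow 2).continuousOn.integrableOn_compact
        (isCompact_closedBall p R)) fun x => ?_
    rw [← jet_inr_inr]
    exact pow_le_pow_left₀ (norm_nonneg _) (PiLp.norm_apply_le _ _) 2
  have hvol : 0 ≤ volume.real (Metric.closedBall p R) := measureReal_nonneg
  have hm : mulOperator (discMeasure p R) c (testField p R φ).fst =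
      ContinuousMap.toLp 2 (discMeasure p R) ℝ ⟨_, hcont⟩ :=
    mulOperator_toLp _ _ _ _ fun x => rfl
  -- The squared value at the centre is at most the volume of the disc times the integral of `‖jet
  -- φ‖²`; this is the source of the factor `1 + volume`.
  rw [← Real.sqrt_sq (norm_nonneg (mulOperator (discMeasure p R) c (testField p R φ).fst)),
    ← Real.sqrt_mul (by positivity)]
  refine Real.le_sqrt_of_sq_le ?_
  rw [WithLp.prod_norm_sq_eq_of_L2, hm, testField_fst, testField_snd,
    norm_toLp_disc_sq (f := jet φ) _ fun x => rfl,
    norm_toLp_disc_sq (f := fun x => a x (jet φ x)) _ fun x => by rw [← hc]; rfl]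
  have h4 := mul_le_mul_of_nonneg_left h3 hvol
  have h5 := mul_le_mul_of_nonneg_left h1 (by linarith :
    0 ≤ 1 + volume.real (Metric.closedBall p R))
  linarith

/-! ### Analyticity of solutions -/

/-- The base points of a disc together with the jet of the vector field `t h`. -/
def deformationJet (p : ℂ) (R : ℝ) {h : ℂ → ℂ} (hh : ContDiff ℝ 2 h) (t : ℂ) :
    C(Metric.closedBall p R, ℂ × Jet) :=
  ⟨fun x => ((x : ℂ) - p, t • jet h x),
    (continuous_subtype_val.sub continuous_const).prodMk
      (((continuous_jet hh).comp continuous_subtype_val).const_smul t)⟩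

theorem deformationJet_apply (p : ℂ) (R : ℝ) {h : ℂ → ℂ} (hh : ContDiff ℝ 2 h) (t : ℂ)
    (x : Metric.closedBall p R) : deformationJet p R hh t x = ((x : ℂ) - p, t • jet h x) := rfl

theorem analyticAt_deformationJet (p : ℂ) (R : ℝ) {h : ℂ → ℂ} (hh : ContDiff ℝ 2 h) (t : ℂ) :
    AnalyticAt ℝ (deformationJet p R hh) t := by
  let Λ : ℂ →ₗ[ℝ] C(Metric.closedBall p R, ℂ × Jet) :=
    { toFun := fun t => deformationJet p R hh t - deformationJet p R hh 0
      map_add' := fun s t => by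
        ext1 x
        simp [deformationJet_apply, add_smul]
      map_smul' := fun c t => by
        ext1 x
        simp [deformationJet_apply, mul_smul] }
  have h1 := (LinearMap.toContinuousLinearMap Λ).analyticAt t
  have h2 : deformationJet p R hh = fun t => deformationJet p R hh 0 + Λ t := by
    ext1 t
    simp [Λ]
  rw [h2]
  exact analyticAt_const.add h1

/-- Base points are measured from `p`, so shrinking the disc brings the undeformed data inside the
radius of the superposition operators. -/
theorem norm_deformationJet_zero_le (p : ℂ) {R : ℝ} (hR : 0 ≤ R) {h : ℂ → ℂ}
    (hh : ContDiff ℝ 2 h) : ‖deformationJet p R hh 0‖ ≤ R := by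
  refine (ContinuousMap.norm_le _ hR).2 fun x => ?_
  rw [deformationJet_apply, zero_smul, Prod.norm_mk, norm_zero]
  exact max_le (by rw [← dist_eq_norm]; exact x.2) hR

/-- The coefficients of the equation after a deformation with jet `z.2` at the point `p + z.1`. -/
def deformedCoeff (a : ℂ → Jet →L[ℝ] ℂ) (p : ℂ) (z : ℂ × Jet) : Jet →L[ℝ] ℂ :=
  -- The inverse of `transport` recovers the jet of the original function at the displaced point.
  (a (p + z.1 + z.2 (.inl ()))).comp (Ring.inverse (transport z.2))

theorem analyticAt_basePoint (p : ℂ) (z : ℂ × Jet) :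
    AnalyticAt ℝ (fun z : ℂ × Jet => p + z.1 + z.2 (.inl ())) z :=
  (analyticAt_const.add analyticAt_fst).add
    (((jetProj (.inl ())).analyticAt _).fun_comp analyticAt_snd)

theorem analyticAt_deformedCoeff {a : ℂ → Jet →L[ℝ] ℂ} {p : ℂ} (ha : AnalyticAt ℝ a p) :
    AnalyticAt ℝ (deformedCoeff a p) 0 := by
  have h1 : AnalyticAt ℝ (fun z : ℂ × Jet => a (p + z.1 + z.2 (.inl ()))) 0 :=
    AnalyticAt.fun_comp (by simpa using ha) (analyticAt_basePoint p 0)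
  have h2 : AnalyticAt ℝ (fun z : ℂ × Jet => transport z.2) 0 :=
    (analyticAt_transport _).fun_comp analyticAt_snd
  have h3 : AnalyticAt ℝ (fun z : ℂ × Jet => Ring.inverse (transport z.2)) 0 := by
    refine AnalyticAt.fun_comp ?_ h2
    have h := analyticAt_inverse (𝕜 := ℝ) (A := Jet →L[ℝ] Jet) 1
    simpa [transport_zero] using h
  exact ((ContinuousLinearMap.compL ℝ Jet Jet ℂ).analyticAt_bilinear _).comp₂ h1 h3

theorem eventually_isUnit_transport :
    ∀ᶠ z : ℂ × Jet in 𝓝 0, IsUnit (transport z.2) := by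
  have h2 : ContinuousAt (fun z : ℂ × Jet => transport z.2) 0 :=
    ((analyticAt_transport _).fun_comp analyticAt_snd).continuousAt
  refine h2.eventually ((Units.isOpen (R := Jet →L[ℝ] Jet)).mem_nhds ?_)
  change IsUnit (transport 0)
  rw [transport_zero]
  exact isUnit_one

/-- A twice continuously differentiable solution of a linear elliptic equation of second order in
the plane is analytic where the coefficients are. -/
theorem analyticAt_of_elliptic_equation {u : ℂ → ℂ} {p : ℂ} (hu : ContDiffAt ℝ 2 u p)
    {a : ℂ → Jet →L[ℝ] ℂ} (ha : AnalyticAt ℝ a p) {f : ℂ → ℂ} (hf : AnalyticAt ℝ f p)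
    {A : Fin 2 → Fin 2 → ℂ}
    (hA : ∀ ξ : Fin 2 → ℝ, ξ ≠ 0 → ∑ i, ∑ j, A i j * ξ i * ξ j ≠ 0)
    (haA : ∀ j : Jet, a p (jetTop j) = ∑ i, ∑ k, A i k * j (.inr (.inr (i, k))))
    (heq : ∀ᶠ x in 𝓝 p, a x (jet u x) = f x) : AnalyticAt ℝ u p := by
  obtain ⟨R₀, hR₀, C, hC, hest⟩ := exists_jet_estimate ha.continuousAt hA haA
  obtain ⟨r₁, hr₁, hS₁⟩ := exists_analytic_superposition (analyticAt_deformedCoeff ha)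
  obtain ⟨r₂, hr₂, hS₂⟩ := exists_analytic_superposition
    (G := fun z : ℂ × Jet => f (p + z.1 + z.2 (.inl ())))
    (AnalyticAt.fun_comp (by simpa using hf) (analyticAt_basePoint p 0))
  obtain ⟨r₃, hr₃, hunit⟩ := Metric.eventually_nhds_iff.1 eventually_isUnit_transport
  obtain ⟨R₂, hR₂, hgood⟩ := Metric.eventually_nhds_iff.1 (heq.and (hu.eventually (by simp)))
  -- For `‖t‖ < R`, points of the disc move by less than `R`, so `2 * R < R₂` keeps them where `u`
  -- is C² and solves the equation.
  obtain ⟨R, hR, hRR₀, hRR₂, hRr⟩ :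
      ∃ R > 0, R ≤ R₀ ∧ 2 * R < R₂ ∧ R < min r₁ (min r₂ r₃) := by
    have h : 0 < min R₀ (min (R₂ / 3) (min r₁ (min r₂ r₃) / 2)) := by positivity
    refine ⟨_, h, min_le_left _ _, ?_, ?_⟩
    · have := (min_le_right R₀ _).trans (min_le_left (R₂ / 3) (min r₁ (min r₂ r₃) / 2))
      linarith
    · have h1 := (min_le_right R₀ _).trans (min_le_right (R₂ / 3) (min r₁ (min r₂ r₃) / 2))
      have h2 : 0 < min r₁ (min r₂ r₃) := by positivity
      linarith
  have : CompactSpace (Metric.closedBall p R) :=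
    isCompact_iff_compactSpace.1 (isCompact_closedBall p R)
  obtain ⟨S₁, hS₁⟩ := hS₁ (Metric.closedBall p R)
  obtain ⟨S₂, hS₂⟩ := hS₂ (Metric.closedBall p R)
  -- Vanishing beyond `R / 2` makes `φ t` zero near the boundary of the disc and outside it, hence
  -- C² on the whole plane although `u` is C² only near `p`.
  let χ : ContDiffBump p := ⟨R / 3, R / 2, by positivity, by linarith⟩
  let h : ℂ → ℂ := fun x => (χ x : ℂ)
  have hh : ContDiff ℝ 2 h := Complex.ofRealCLM.contDiff.comp χ.contDiff
  have hχ1 (x : ℂ) : ‖h x‖ ≤ 1 := by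
    simp only [h, Complex.norm_real, Real.norm_of_nonneg χ.nonneg]
    exact χ.le_one
  have hχ0 (x : ℂ) (hx : R / 2 < dist x p) : h =ᶠ[𝓝 x] 0 := by
    filter_upwards [(isOpen_lt continuous_const (continuous_id.dist continuous_const)).mem_nhds hx]
      with y hy
    have hy0 : χ y = 0 := χ.zero_of_le_dist (le_of_lt hy)
    simp [h, hy0]
  let ξ := deformationJet p R hh
  have hξ : AnalyticAt ℝ ξ 0 := analyticAt_deformationJet p R hh 0
  have hξ0 : ‖ξ 0‖ < min r₁ (min r₂ r₃) := (norm_deformationJet_zero_le p hR.le hh).trans_lt hRr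
  have hξr : ∀ᶠ t in 𝓝 0, ‖ξ t‖ < min r₁ (min r₂ r₃) :=
    hξ.continuousAt.norm.eventually (gt_mem_nhds hξ0)
  let μ := discMeasure p R
  have hjuc : Continuous fun x : Metric.closedBall p R => jet u x := by
    rw [continuous_iff_continuousAt]
    intro x
    have hx : dist (x : ℂ) p < R₂ := by linarith [Metric.mem_closedBall.1 x.2]
    exact ContinuousAt.comp (g := jet u) (continuousAt_jet (hgood hx).2)
      continuous_subtype_val.continuousAt
  let ju : C(Metric.closedBall p R, Jet) := ⟨_, hjuc⟩
  -- The operator sees only the jets; on test fields its lower bound still controls the value at the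
  -- centre.
  let P : ℂ → JetField p R →L[ℝ] Lp ℂ 2 μ := fun t =>
    (mulOperator μ (S₁ (ξ t))).comp (WithLp.fstL 2 ℝ (Lp Jet 2 μ) ℂ)
  let g : ℂ → Lp ℂ 2 μ := fun t => ContinuousMap.toLp 2 μ ℝ (S₂ (ξ t)) -
    mulOperator μ (S₁ (ξ t)) (ContinuousMap.toLp 2 μ ℝ ju)
  have hS₁ξ : AnalyticAt ℝ (fun t => S₁ (ξ t)) 0 :=
    (hS₁ _ (hξ0.trans_le (min_le_left _ _))).1.fun_comp hξ
  have hS₂ξ : AnalyticAt ℝ (fun t => S₂ (ξ t)) 0 :=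
    (hS₂ _ (hξ0.trans_le ((min_le_right _ _).trans (min_le_left _ _)))).1.fun_comp hξ
  have hM : AnalyticAt ℝ (fun t => mulOperator μ (S₁ (ξ t))) 0 :=
    ((mulOperator μ).analyticAt _).fun_comp hS₁ξ
  have hP : AnalyticAt ℝ P 0 :=
    (((ContinuousLinearMap.compL ℝ (JetField p R) (Lp Jet 2 μ) (Lp ℂ 2 μ)).flip
      (WithLp.fstL 2 ℝ (Lp Jet 2 μ) ℂ)).analyticAt _).fun_comp hM
  have hg : AnalyticAt ℝ g 0 := by
    refine AnalyticAt.sub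
      (((ContinuousMap.toLp (E := ℂ) 2 μ ℝ).analyticAt _).fun_comp hS₂ξ) ?_
    exact ((ContinuousLinearMap.id ℝ (Lp Jet 2 μ →L[ℝ] Lp ℂ 2 μ)).analyticAt_bilinear _).comp₂ hM
      analyticAt_const
  let φ : ℂ → ℂ → ℂ := fun t x => u (x + t * h x) - u x
  -- the differences are test functions
  have hmove (t : ℂ) (ht : ‖t‖ < R) (x : ℂ) (hx : dist x p ≤ R) : dist (x + t * h x) p < R₂ := by
    have h1 : ‖t * h x‖ ≤ ‖t‖ := by
      rw [norm_mul]
      exact mul_le_of_le_one_right (norm_nonneg _) (hχ1 x)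
    have h2 : dist (x + t * h x) p ≤ dist x p + ‖t * h x‖ := by
      rw [dist_eq_norm, dist_eq_norm, add_sub_right_comm]
      exact norm_add_le _ _
    linarith
  have hcomp (t : ℂ) (ht : ‖t‖ < R) (x : ℂ) (hx : dist x p ≤ R) :
      ContDiffAt ℝ 2 (fun y => u (y + t * h y)) x :=
    ContDiffAt.comp x (g := u) (hgood (hmove t ht x hx)).2
      (contDiffAt_id.add (contDiffAt_const.mul hh.contDiffAt))
  have hφV (t : ℂ) (ht : ‖t‖ < R) : φ t ∈ testFunctions p R := by
    have hzero (x : ℂ) (hx : R / 2 < dist x p) : φ t =ᶠ[𝓝 x] fun _ => 0 := by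
      filter_upwards [hχ0 x hx] with y hy
      simp [φ, hy]
    refine ⟨contDiff_iff_contDiffAt.2 fun x => ?_, fun x hx => ?_⟩
    · by_cases hx : dist x p ≤ R
      · exact (hcomp t ht x hx).sub (hgood (by linarith)).2
      · exact contDiffAt_const.congr_of_eventuallyEq (hzero x (by linarith [not_le.1 hx]))
    · refine (hzero x ?_).eq_of_nhds
      rw [Metric.mem_closedBall, not_le] at hx
      linarith
  classical
  -- The value 0 is a default, irrelevant for `t` near 0.
  let w : ℂ → JetField p R := fun t =>
    if ht : φ t ∈ testFunctions p R then testField p R ⟨φ t, ht⟩ else 0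
  have hball : ∀ᶠ t : ℂ in 𝓝 0, ‖t‖ < R := by
    have := Metric.ball_mem_nhds (0 : ℂ) hR
    filter_upwards [this] with t ht
    simpa using ht
  have hwV : ∀ᶠ t in 𝓝 0, w t ∈ (testField p R).range := by
    filter_upwards [hball] with t ht
    simp only [w, dif_pos (hφV t ht)]
    exact ⟨_, rfl⟩
  have hbelow : ∀ v ∈ (testField p R).range,
      ‖v‖ ≤ √((1 + volume.real (Metric.closedBall p R)) * C) * ‖P 0 v‖ := by
    rintro _ ⟨ψ, rfl⟩
    refine norm_testField_le (a := a) hC.le (S₁ (ξ 0)) (fun x => ?_)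
      (fun ψ => hest R hR.le hRR₀ ψ) ψ
    rw [(hS₁ _ (hξ0.trans_le (min_le_left _ _))).2 x]
    simp only [ξ, deformationJet_apply, zero_smul, deformedCoeff, transport_zero,
      Ring.inverse_one]
    simp [ContinuousLinearMap.one_def]
  have hsol : ∀ᶠ t in 𝓝 0, P t (w t) = g t := by
    filter_upwards [hball, hξr] with t ht htr
    simp only [w, dif_pos (hφV t ht)]
    change mulOperator μ (S₁ (ξ t)) (ContinuousMap.toLp 2 μ ℝ (testJet p R ⟨φ t, hφV t ht⟩)) = g t
    rw [eq_sub_iff_add_eq, ← map_add, ← map_add]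
    refine mulOperator_toLp _ _ _ _ fun x => ?_
    have hx : dist (x : ℂ) p ≤ R := x.2
    have hxm := hmove t ht x hx
    have e1 : (testJet p R ⟨φ t, hφV t ht⟩ + ju) x = jet (fun y => u (y + t * h y)) x := by
      change jet (φ t) x + jet u x = _
      rw [jet_sub (hcomp t ht x hx) (hgood (by linarith)).2, sub_add_cancel]
    have e2 := jet_comp_id_add (x := (x : ℂ)) (h := fun y => t * h y) (hgood hxm).2
      (contDiffAt_const.mul hh.contDiffAt)
    have e3 : IsUnit (transport (t • jet h x)) := by
      have h1 : ‖ξ t x‖ < r₃ := ((ξ t).norm_coe_le_norm x).trans_lt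
        (htr.trans_le ((min_le_right _ _).trans (min_le_right _ _)))
      exact hunit (y := ξ t x) (by rwa [dist_zero_right])
    have e4 : p + ((x : ℂ) - p) + (t • jet h x).ofLp (.inl ()) = x + t * h x := by
      rw [add_sub_cancel]; rfl
    rw [e1, e2, (hS₁ _ (htr.trans_le (min_le_left _ _))).2 x,
      (hS₂ _ (htr.trans_le ((min_le_right _ _).trans (min_le_left _ _)))).2 x,
      jet_const_mul t hh.contDiffAt]
    simp only [ξ, deformationJet_apply, deformedCoeff, e4, ContinuousLinearMap.comp_apply]
    have e5 (q : Jet) : Ring.inverse (transport (t • jet h x)) (transport (t • jet h x) q) = q :=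
      congrArg (fun B : Jet →L[ℝ] Jet => B q) (Ring.inverse_mul_cancel _ e3)
    rw [e5]
    exact (hgood hxm).1
  have hw := analyticAt_of_bounded_below (testField p R).range hP hg hbelow hwV hsol
  have hw2 : AnalyticAt ℝ (fun t => (w t).snd) 0 :=
    ((WithLp.sndL 2 ℝ (Lp Jet 2 μ) ℂ).analyticAt _).fun_comp hw
  have hval : ∀ᶠ t in 𝓝 0, (w t).snd + u p = u (p + t) := by
    filter_upwards [hball] with t ht
    simp only [w, dif_pos (hφV t ht)]
    have h1 : h p = 1 := by
      simp [h, χ.one_of_mem_closedBall (Metric.mem_closedBall_self (by positivity))]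
    change u (p + t * h p) - u p + u p = _
    rw [h1, mul_one, sub_add_cancel]
  have hup : AnalyticAt ℝ (fun t => u (p + t)) 0 :=
    (hw2.add analyticAt_const).congr hval
  have hfin : AnalyticAt ℝ (fun x => u (p + (x - p))) p :=
    AnalyticAt.fun_comp (g := fun t => u (p + t)) (by simpa using hup)
      (analyticAt_id.sub analyticAt_const)
  simpa using hfin

/-! ### The Laplacian of a complex metric in coordinates -/

theorem inv_apply_fin_two (B : Matrix (Fin 2) (Fin 2) ℂ) (i j : Fin 2) :
    B⁻¹ i j = (B 0 0 * B 1 1 - B 0 1 * B 1 0)⁻¹ * (!![B 1 1, -B 0 1; -B 1 0, B 0 0] i j) := by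
  rw [Matrix.inv_def, Matrix.adjugate_fin_two, Matrix.det_fin_two, Ring.inverse_eq_inv']
  rfl

theorem analyticAt_inv_apply {g : ℂ → Matrix (Fin 2) (Fin 2) ℂ} {p : ℂ}
    (hg : ∀ i j, AnalyticAt ℝ (fun z => g z i j) p) (hdet : (g p).det ≠ 0) (i j : Fin 2) :
    AnalyticAt ℝ (fun z => (g z)⁻¹ i j) p := by
  simp only [inv_apply_fin_two]
  rw [Matrix.det_fin_two] at hdet
  refine AnalyticAt.mul
    ((((hg 0 0).mul (hg 1 1)).sub ((hg 0 1).mul (hg 1 0))).inv hdet) ?_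
  fin_cases i <;> fin_cases j
  · exact hg 1 1
  · exact (hg 0 1).neg
  · exact (hg 1 0).neg
  · exact hg 0 0

theorem analyticAt_pd {f : ℂ → ℂ} {p : ℂ} (hf : AnalyticAt ℝ f p) (i : Fin 2) :
    AnalyticAt ℝ (pd i f) p :=
  ((ContinuousLinearMap.apply ℝ ℂ (frame i)).analyticAt _).fun_comp hf.fderiv

theorem analyticAt_christoffel {g : ℂ → Matrix (Fin 2) (Fin 2) ℂ} {p : ℂ}
    (hg : ∀ i j, AnalyticAt ℝ (fun z => g z i j) p) (hdet : (g p).det ≠ 0) (k i j : Fin 2) :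
    AnalyticAt ℝ (christoffel g k i j) p := by
  refine AnalyticAt.mul analyticAt_const (Finset.analyticAt_fun_sum _ fun l _ => ?_)
  exact (analyticAt_inv_apply hg hdet k l).mul
    (((analyticAt_pd (hg j l) i).add (analyticAt_pd (hg i l) j)).sub (analyticAt_pd (hg i j) l))

/-- The first order coefficients of the Laplacian. -/
def laplacianDrift (g : ℂ → Matrix (Fin 2) (Fin 2) ℂ) (l : Fin 2) (z : ℂ) : ℂ :=
  ∑ i, (pd i (fun q => (g q)⁻¹ i l) z + ∑ j, christoffel g i i j z * (g z)⁻¹ j l)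

theorem analyticAt_laplacianDrift {g : ℂ → Matrix (Fin 2) (Fin 2) ℂ} {p : ℂ}
    (hg : ∀ i j, AnalyticAt ℝ (fun z => g z i j) p) (hdet : (g p).det ≠ 0) (l : Fin 2) :
    AnalyticAt ℝ (laplacianDrift g l) p :=
  Finset.analyticAt_fun_sum _ fun i _ => (analyticAt_pd (analyticAt_inv_apply hg hdet i l) i).add
    (Finset.analyticAt_fun_sum _ fun j _ =>
      (analyticAt_christoffel hg hdet i i j).mul (analyticAt_inv_apply hg hdet j l))

/-- Tracing with the inverse metric undoes the lowering of an index in the Hessian, so the Laplacian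
is the divergence of the gradient. -/
theorem trace_contract {B : Matrix (Fin 2) (Fin 2) ℂ} (hs : B.IsSymm) (hdet : B.det ≠ 0)
    (c : Fin 2 → Fin 2 → ℂ) : ∑ i, ∑ j, B⁻¹ i j * ∑ k, c i k * B k j = ∑ i, c i i := by
  have h1 : B⁻¹ * B = 1 := Matrix.nonsing_inv_mul _ (isUnit_iff_ne_zero.2 hdet)
  have h2 (i k : Fin 2) : B⁻¹ i 0 * B k 0 + B⁻¹ i 1 * B k 1 = (1 : Matrix _ _ ℂ) i k := by
    rw [← h1, Matrix.mul_apply, Fin.sum_univ_two, hs.apply k 0, hs.apply k 1]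
  have h00 := h2 0 0
  have h01 := h2 0 1
  have h10 := h2 1 0
  have h11 := h2 1 1
  simp only [Matrix.one_apply_eq, Matrix.one_apply_ne (zero_ne_one (α := Fin 2)),
    Matrix.one_apply_ne (one_ne_zero (α := Fin 2))] at h00 h01 h10 h11
  simp only [Fin.sum_univ_two]
  linear_combination c 0 0 * h00 + c 0 1 * h01 + c 1 0 * h10 + c 1 1 * h11

theorem laplacian_eq {g : ℂ → Matrix (Fin 2) (Fin 2) ℂ} {u : ℂ → ℂ} {z : ℂ}
    (hg : ∀ i j, AnalyticAt ℝ (fun z => g z i j) z) (hs : (g z).IsSymm) (hdet : (g z).det ≠ 0)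
    (hu : ContDiffAt ℝ 2 u z) :
    laplacian g u z = ∑ i, ∑ l, (g z)⁻¹ i l * pd i (pd l u) z +
      ∑ l, laplacianDrift g l z * pd l u z := by
  have hG (i l : Fin 2) : DifferentiableAt ℝ (fun q => (g q)⁻¹ i l) z :=
    (analyticAt_inv_apply hg hdet i l).differentiableAt
  have hd (l : Fin 2) : DifferentiableAt ℝ (pd l u) z :=
    (contDiffAt_pd l hu).differentiableAt one_ne_zero
  have hgrad (i : Fin 2) : pd i (fun q => grad g u q i) z =
      ∑ l, (pd i (fun q => (g q)⁻¹ i l) z * pd l u z + (g z)⁻¹ i l * pd i (pd l u) z) := by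
    simp only [grad, Fin.sum_univ_two]
    rw [pd_add ((hG i 0).fun_mul (hd 0)) ((hG i 1).fun_mul (hd 1)), pd_mul (hG i 0) (hd 0),
      pd_mul (hG i 1) (hd 1)]
  have h1 : laplacian g u z = ∑ i, covDeriv g (grad g u) i i z :=
    trace_contract hs hdet fun i k => covDeriv g (grad g u) i k z
  rw [h1]
  simp only [covDeriv, hgrad, laplacianDrift]
  simp only [grad, Fin.sum_univ_two]
  ring

/-- In dimension two the inverse is the adjugate over the determinant, so `g⁻¹(ξ, ξ) = g(η, η) / det
g` with `η = (ξ₁, -ξ₀)`. A real zero `ξ` would therefore give a real isotropic direction. -/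
theorem inverse_form_ne_zero {g : ℂ → Matrix (Fin 2) (Fin 2) ℂ} {U : Set ℂ}
    (hg : IsPositiveComplexMetricOn g U) {p : ℂ} (hp : p ∈ U) (ξ : Fin 2 → ℝ) (hξ : ξ ≠ 0) :
    ∑ i, ∑ j, (g p)⁻¹ i j * ξ i * ξ j ≠ 0 := by
  intro h
  have hdet := hg.nondegenerate p hp
  rw [Matrix.det_fin_two] at hdet
  let η : Fin 2 → ℝ := ![ξ 1, -ξ 0]
  have hη : (fun i => (η i : ℂ)) ≠ 0 := by
    intro h0
    apply hξ
    have h1 := congrFun h0 0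
    have h2 := congrFun h0 1
    simp [η] at h1 h2
    ext i
    fin_cases i
    · exact h2
    · exact h1
  refine hg.not_real p hp (Projectivization.mk ℂ _ hη) ⟨_, hη, rfl, ?_⟩ ⟨η, hη, rfl⟩
  simp only [inv_apply_fin_two, Fin.sum_univ_two] at h
  simp only [η, Fin.sum_univ_two]
  simp at h ⊢
  have h' : (g p 0 0 * g p 1 1 - g p 0 1 * g p 1 0)⁻¹ *
      (g p 0 0 * ξ 1 * ξ 1 + -(g p 0 1 * ξ 1 * ξ 0) +
        (-(g p 1 0 * ξ 0 * ξ 1) + g p 1 1 * ξ 0 * ξ 0)) = 0 := by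
    linear_combination h
  exact (mul_eq_zero.1 h').resolve_left (inv_ne_zero hdet)

/-! ### The affine nonlinearity -/

/-- The affine map attached to each `z` comes with no regularity in `z`. Expressing its coefficients
by difference quotients at fixed points makes them analytic in `z`, as `F (·, v)` is. -/
theorem affine_apply_eq (A : (ℂ × ℂ × ℂ) →ᵃ[ℂ] ℂ) (v₀ v : ℂ × ℂ × ℂ) {δ : ℂ} (hδ : δ ≠ 0) :
    A v = A v₀ + (A (v₀ + (δ, 0, 0)) - A v₀) / δ * (v.1 - v₀.1) +
      (A (v₀ + (0, δ, 0)) - A v₀) / δ * (v.2.1 - v₀.2.1) +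
      (A (v₀ + (0, 0, δ)) - A v₀) / δ * (v.2.2 - v₀.2.2) := by
  have h (w : ℂ × ℂ × ℂ) : A (v₀ + w) = A v₀ + A.linear w := by
    have := A.map_vadd v₀ w
    simpa [add_comm] using this
  have hv : v = v₀ + (v - v₀) := by simp
  have hw : v - v₀ = ((v.1 - v₀.1) / δ) • ((δ, 0, 0) : ℂ × ℂ × ℂ) +
      ((v.2.1 - v₀.2.1) / δ) • ((0, δ, 0) : ℂ × ℂ × ℂ) +
      ((v.2.2 - v₀.2.2) / δ) • ((0, 0, δ) : ℂ × ℂ × ℂ) := by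
    ext <;> simp [hδ]
  conv_lhs => rw [hv, h, hw, map_add, map_add, map_smul, map_smul, map_smul]
  simp only [h, smul_eq_mul]
  ring

end ComplexMetric

end

/-! ### Reduction of the equation to a linear elliptic one -/

open ComplexMetric Filter Topology in
theorem mainTheorem5
    (U : Set ℂ) (hU : IsOpen U)
    (V : Set (ℂ × ℂ × ℂ)) (hV : IsOpen V)
    (g : ℂ → Matrix (Fin 2) (Fin 2) ℂ)
    (hg : ComplexMetric.IsPositiveComplexMetricOn g U)
    (hg_analytic : ∀ i j, AnalyticOnNhd ℝ (fun z => g z i j) U)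
    (F : ℂ × (ℂ × ℂ × ℂ) → ℂ)
    (hF_analytic : AnalyticOnNhd ℝ F (U ×ˢ V))
    (hF_linear : ∀ z ∈ U, ∃ A : (ℂ × ℂ × ℂ) →ᵃ[ℂ] ℂ, ∀ v ∈ V, F (z, v) = A v)
    (u : ℂ → ℂ) (hu : ContDiffOn ℝ 2 u U)
    (huV : ∀ z ∈ U, (u z, ComplexMetric.dz u z, ComplexMetric.dzbar u z) ∈ V)
    (hu_eq : ∀ z ∈ U, ComplexMetric.laplacian g u z +
      F (z, u z, ComplexMetric.dz u z, ComplexMetric.dzbar u z) = 0) :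
    AnalyticOnNhd ℝ u U := by
  intro p hp
  set v₀ : ℂ × ℂ × ℂ := (u p, dz u p, dzbar u p) with hv₀
  have hv₀V : v₀ ∈ V := huV p hp
  obtain ⟨ε, hε, hεV⟩ := Metric.isOpen_iff.1 hV v₀ hv₀V
  -- Small enough that `v₀` and its three displacements by `δ` along the axes all lie in `V`.
  let δ : ℂ := ((ε / 2 : ℝ) : ℂ)
  have hδ : δ ≠ 0 := Complex.ofReal_ne_zero.2 (by positivity)
  have hδn : ‖δ‖ < ε := by
    rw [Complex.norm_real, Real.norm_of_nonneg (by positivity)]; linarith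
  have hmem (w : ℂ × ℂ × ℂ) (hw : ‖w‖ ≤ ‖δ‖) : v₀ + w ∈ V :=
    hεV (by rw [Metric.mem_ball, dist_self_add_left]; linarith)
  have hw₁ : v₀ + (δ, 0, 0) ∈ V := hmem _ (by simp [Prod.norm_mk])
  have hw₂ : v₀ + (0, δ, 0) ∈ V := hmem _ (by simp [Prod.norm_mk])
  have hw₃ : v₀ + (0, 0, δ) ∈ V := hmem _ (by simp [Prod.norm_mk])
  have hFa {v : ℂ × ℂ × ℂ} (hv : v ∈ V) : AnalyticAt ℝ (fun z => F (z, v)) p :=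
    AnalyticAt.fun_comp (f := fun z => (z, v)) (hF_analytic (p, v) ⟨hp, hv⟩)
      (analyticAt_id.prod analyticAt_const)
  let c (w : ℂ × ℂ × ℂ) (z : ℂ) : ℂ := (F (z, v₀ + w) - F (z, v₀)) / δ
  have hc {w : ℂ × ℂ × ℂ} (hw : v₀ + w ∈ V) : AnalyticAt ℝ (c w) p := by
    simp only [c, div_eq_mul_inv]
    exact ((hFa hw).sub (hFa hv₀V)).mul analyticAt_const
  let c₁ := c (δ, 0, 0)
  let c₂ := c (0, δ, 0)
  let c₃ := c (0, 0, δ)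
  have hFeq (z : ℂ) (hz : z ∈ U) : F (z, u z, dz u z, dzbar u z) = F (z, v₀) +
      c₁ z * (u z - v₀.1) + c₂ z * (dz u z - v₀.2.1) + c₃ z * (dzbar u z - v₀.2.2) := by
    obtain ⟨A, hA⟩ := hF_linear z hz
    rw [hA _ (huV z hz), affine_apply_eq A v₀ _ hδ]
    simp only [c₁, c₂, c₃, c, hA _ hw₁, hA _ hw₂, hA _ hw₃, hA _ hv₀V]
  have hga (i j : Fin 2) : AnalyticAt ℝ (fun z => g z i j) p := hg_analytic i j p hp
  have hdet := hg.nondegenerate p hp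
  -- The Wirtinger terms `c₂ ∂_z + c₃ ∂_{z̄}` rewritten in the frame `∂_x, ∂_y` and added to the
  -- drift of the Laplacian.
  let b : Fin 2 → ℂ → ℂ := ![fun z => laplacianDrift g 0 z + (c₂ z + c₃ z) / 2,
    fun z => laplacianDrift g 1 z + Complex.I * (c₃ z - c₂ z) / 2]
  have hb (l : Fin 2) : AnalyticAt ℝ (b l) p := by
    fin_cases l
    · exact (analyticAt_laplacianDrift hga hdet 0).add
        (((hc hw₂).add (hc hw₃)).div analyticAt_const two_ne_zero)
    · exact (analyticAt_laplacianDrift hga hdet 1).add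
        ((analyticAt_const.mul ((hc hw₃).sub (hc hw₂))).div analyticAt_const two_ne_zero)
  let a : ℂ → Jet →L[ℝ] ℂ := fun z =>
    ∑ i, ∑ j, (g z)⁻¹ i j • jetProj (.inr (.inr (i, j))) +
      (∑ l, b l z • jetProj (.inr (.inl l)) + c₁ z • jetProj (.inl ()))
  have ha : AnalyticAt ℝ a p :=
    (Finset.analyticAt_fun_sum _ fun i _ => Finset.analyticAt_fun_sum _ fun j _ =>
      (analyticAt_inv_apply hga hdet i j).fun_smul analyticAt_const).add
      ((Finset.analyticAt_fun_sum _ fun l _ => (hb l).fun_smul analyticAt_const).add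
        ((hc hw₁).fun_smul analyticAt_const))
  let f : ℂ → ℂ := fun z => c₁ z * v₀.1 + c₂ z * v₀.2.1 + c₃ z * v₀.2.2 - F (z, v₀)
  have hf : AnalyticAt ℝ f p :=
    ((((hc hw₁).mul analyticAt_const).add ((hc hw₂).mul analyticAt_const)).add
      ((hc hw₃).mul analyticAt_const)).sub (hFa hv₀V)
  refine analyticAt_of_elliptic_equation (hu.contDiffAt (hU.mem_nhds hp)) ha hf
    (A := fun i j => (g p)⁻¹ i j) (inverse_form_ne_zero hg hp) (fun j => ?_) ?_
  · simp [a, jetProj_apply, jetTop]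
  · filter_upwards [hU.mem_nhds hp] with z hz
    have h1 := hu_eq z hz
    rw [hFeq z hz, laplacian_eq (fun i j => hg_analytic i j z hz) (hg.symm z hz)
      (hg.nondegenerate z hz) (hu.contDiffAt (hU.mem_nhds hz))] at h1
    simp only [a, f, b, add_apply, sum_apply, smul_apply, jetProj_apply, jet_inl, jet_inr_inl,
      jet_inr_inr, smul_eq_mul]
    simp only [Fin.sum_univ_two, dz, dzbar, Matrix.cons_val_zero, Matrix.cons_val_one] at h1 ⊢
    linear_combination h1
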